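/- Let $d\ge 1$ and let $D\subset\mathbb{R}^d$ be a bounded open set. A log-correlated field on $D$ is a random (real) distribution $X$ on $D$, defined on some probability space, such that the family $(\langle X,\psi\rangle)_{\psi\in C_c^\infty(D)}$ is a centered Gaussian process and, for some $h\in C_c^\infty(\mathbb{R}^d)$, $$\mathbb{E}\big[\langle X,\psi_1\rangle\langle X,\psi_2\rangle\big]=\int_D\int_D R(y,z)\,\psi_1(y)\psi_2(z)\,dz\,dy\quad(\psi_1,\psi_2\in C_c^\infty(D)),\qquad R(y,z)=\log\frac{1}{|z-y|}+h(z-y).$$ For $\alpha\in(0,d)$ put $$G_\alpha\phi(z)=\int_D e^{\alpha R(z,y)}\phi(y)\,dy=\int_D|z-y|^{-\alpha}e^{\alpha h(y-z)}\phi(y)\,dy .$$ For $s>0$ let $W^{s,2}(\mathbb{R}^d)$ be the space of tempered distributions $f$ whose Fourier transform $\mathcal{F}f$ is a locally integrable function with $\|f\|_{W^{s,2}(\mathbb{R}^d)}^2=\int_{\mathbb{R}^d}(1+|\xi|^2)^s|\mathcal{F}f(\xi)|^2\,d\xi<\infty$, let $W^{s,2}(D)$ be the space of restrictions to $D$ of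 elements of $W^{s,2}(\mathbb{R}^d)$ with the norm $\|f\|_{W^{s,2}(D)}=\inf\{\|g\|_{W^{s,2}(\mathbb{R}^d)}: g|_D=f\}$, and let $W_0^{-s,2}(D)$ be its topological dual. A function $\psi\in C_c^\infty(D)$ is regarded as the element $f\mapsto\langle f,\psi\rangle$ of $W_0^{-s,2}(D)$, with the dual norm. For $\beta\in(0,\sqrt d)$ the field $\beta X$ is called $\beta$-non-degenerate on $D$ if, with $s_\beta=\frac{d-\beta^2}{2}$, there is a constant $c_0>0$ such that $$\int_D\psi(z)\,G_{\beta^2}\psi(z)\,dz\;\ge\;c_0\,\|\psi\|^2_{W_0^{-s_\beta,2}(D)}\qquad\text{for all real }\psi\in C_c^\infty(D).$$ Then there exists a log-correlated field $X$ on $D$ such that, for every $\beta\in(0,\sqrt d)$, the field $\beta X$ is $\beta$-non-degenerate on $D$. -/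

import Mathlib

open MeasureTheory ProbabilityTheory TopologicalSpace
open scoped ENNReal SchwartzMap Distributions FourierTransform

namespace LogCorrelated

/-- The Euclidean space `ℝ^d`. -/
abbrev Rn (d : ℕ) : Type := EuclideanSpace ℝ (Fin d)

noncomputable section

/-! ### Fractional Sobolev spaces -/

/-- A real test function on `D`, viewed as a complex valued Schwartz function on `ℝ^d`. -/
def toSchwartz {d : ℕ} {D : Opens (Rn d)} (ψ : 𝓓(D, ℝ)) : 𝓢(Rn d, ℂ) :=
  HasCompactSupport.toSchwartzMap (f := fun x => ((ψ x : ℝ) : ℂ))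
    (ψ.hasCompactSupport.comp_left (g := fun t : ℝ => (t : ℂ)) Complex.ofReal_zero)
    (Complex.ofRealCLM.contDiff.comp ψ.contDiff)

/-- The tempered distribution `f` has a Fourier transform that is a locally integrable function,
namely `u`. -/
def HasFourierFunction {d : ℕ} (f : 𝓢'(Rn d, ℂ)) (u : Rn d → ℂ) : Prop :=
  LocallyIntegrable u volume ∧ ∀ φ : 𝓢(Rn d, ℂ), (𝓕 f) φ = ∫ ξ, φ ξ * u ξ

/-- The `W^{s,2}(ℝ^d)` norm `(∫ (1 + |ξ|²)^s |𝓕 f(ξ)|² dξ)^{1/2}`, with values in `[0, ∞]`. It is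
`∞` if `f` is not in `W^{s,2}(ℝ^d)`, in particular if `𝓕 f` is not a locally integrable function;
the infimum is over a family of functions that all agree almost everywhere. -/
def sobolevNorm {d : ℕ} (s : ℝ) (f : 𝓢'(Rn d, ℂ)) : ℝ≥0∞ :=
  ⨅ (u : Rn d → ℂ) (_ : HasFourierFunction f u),
    (∫⁻ ξ, ENNReal.ofReal ((1 + ‖ξ‖ ^ 2) ^ s) * ‖u ξ‖ₑ ^ 2) ^ (1 / 2 : ℝ)

/-- `f` is the restriction to `D` of the tempered distribution `g`. -/
def IsRestriction {d : ℕ} {D : Opens (Rn d)} (g : 𝓢'(Rn d, ℂ)) (f : 𝓓'(D, ℂ)) : Prop :=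
  ∀ ψ : 𝓓(D, ℝ), f ψ = g (toSchwartz ψ)

/-- The quotient norm of `W^{s,2}(D)`, the infimum of the `W^{s,2}(ℝ^d)` norms of all extensions.
It is `∞` exactly when `f` is not in `W^{s,2}(D)`. -/
def sobolevNormOn {d : ℕ} {D : Opens (Rn d)} (s : ℝ) (f : 𝓓'(D, ℂ)) : ℝ≥0∞ :=
  ⨅ (g : 𝓢'(Rn d, ℂ)) (_ : IsRestriction g f), sobolevNorm s g

/-- The norm of a test function `ψ` in `W_0^{-s,2}(D)`, the topological dual of `W^{s,2}(D)`: the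
operator norm of the functional `f ↦ ⟨f, ψ⟩` on `W^{s,2}(D)`. -/
def dualSobolevNorm {d : ℕ} {D : Opens (Rn d)} (s : ℝ) (ψ : 𝓓(D, ℝ)) : ℝ≥0∞ :=
  ⨆ (f : 𝓓'(D, ℂ)) (_ : sobolevNormOn s f ≤ 1), ‖f ψ‖ₑ

/-! ### Log-correlated fields -/

/-- The kernel `R(y,z) = log (1 / |z - y|) + h (z - y)`. -/
def covKernel {d : ℕ} (h : Rn d → ℝ) (y z : Rn d) : ℝ :=
  Real.log (1 / ‖z - y‖) + h (z - y)

/-- The random distribution `X` on `D` is a centered Gaussian field whose covariance operator has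
the kernel `log (1 / |z - y|) + h (z - y)` on `D × D`, with `h` smooth and compactly supported. -/
structure IsLogCorrelatedWith {d : ℕ} (D : Opens (Rn d)) {Ω : Type*} [MeasurableSpace Ω]
    (P : Measure Ω) (X : Ω → 𝓓'(D, ℝ)) (h : Rn d → ℝ) : Prop where
  measurable : ∀ ψ : 𝓓(D, ℝ), Measurable fun ω => X ω ψ
  gaussian : IsGaussianProcess (fun (ψ : 𝓓(D, ℝ)) (ω : Ω) => X ω ψ) P
  centered : ∀ ψ : 𝓓(D, ℝ), ∫ ω, X ω ψ ∂P = 0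
  smooth : ContDiff ℝ (⊤ : ℕ∞) h
  compactSupport : HasCompactSupport h
  covariance : ∀ ψ₁ ψ₂ : 𝓓(D, ℝ),
    ∫ ω, X ω ψ₁ * X ω ψ₂ ∂P
      = ∫ y in (D : Set (Rn d)), ∫ z in (D : Set (Rn d)), covKernel h y z * ψ₁ y * ψ₂ z

/-- `X` is a log-correlated Gaussian field on `D`. -/
def IsLogCorrelated {d : ℕ} (D : Opens (Rn d)) {Ω : Type*} [MeasurableSpace Ω]
    (P : Measure Ω) (X : Ω → 𝓓'(D, ℝ)) : Prop :=
  ∃ h : Rn d → ℝ, IsLogCorrelatedWith D P X h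

/-- The operator `G_α φ(z) = ∫_D exp (α R(z,y)) φ(y) dy`; its kernel is
`|z - y|^{-α} exp (α h(y - z))` for `y ≠ z`. -/
def opG {d : ℕ} (D : Opens (Rn d)) (h : Rn d → ℝ) (α : ℝ) (φ : Rn d → ℝ) (z : Rn d) : ℝ :=
  ∫ y in (D : Set (Rn d)), Real.exp (α * covKernel h z y) * φ y

/-- The field `β X` is `β`-non-degenerate on `D`. The law of `X` determines the values of `h` on
`D - D`, which are the only ones that matter here. -/
def IsNonDegenerate {d : ℕ} (D : Opens (Rn d)) {Ω : Type*} [MeasurableSpace Ω]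
    (P : Measure Ω) (X : Ω → 𝓓'(D, ℝ)) (β : ℝ) : Prop :=
  ∃ h : Rn d → ℝ, IsLogCorrelatedWith D P X h ∧
    ∃ c₀ : ℝ, 0 < c₀ ∧ ∀ ψ : 𝓓(D, ℝ),
      dualSobolevNorm (((d : ℝ) - β ^ 2) / 2) ψ < ∞ ∧
      c₀ * (dualSobolevNorm (((d : ℝ) - β ^ 2) / 2) ψ).toReal ^ 2
        ≤ ∫ z in (D : Set (Rn d)), ψ z * opG D h (β ^ 2) ψ z

end

end LogCorrelated

/-!
The field is the stationary Gaussian field with covariance `K (y - z)`, where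
`K x = -(1/2) log (1 - exp (-|x|²))`. Since `(1 - exp (-r)) / r` is smooth and positive, `K` differs
from `log (1 / |x|)` by a smooth function, which is cut off outside `D - D` to give `h`
(`exists_covKernel_eq`). The point of this choice is that both `K` and its exponentials are sums of
Gaussians with nonnegative coefficients:
`K x = ∑ exp (-n |x|²) / (2 n)` over `n ≥ 1`, and
`exp (α K x) = (1 - exp (-|x|²)) ^ (-a) = ∑ multichoose a n * exp (-n |x|²)` with `a = α / 2`.

*Non-degeneracy.* The Fourier transform turns the second sum into a sum of Gaussians of variance
proportional to `n`, with positive weights comparable to `n ^ (a - 1 - d / 2)` by Euler's limit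
formula for the Gamma function (`exists_multichoose_bounds`). The terms with `n` between `1 + |ξ|²`
and twice that already contribute a multiple of `(1 + |ξ|²) ^ (-(d / 2 - a))`, so that the quadratic
form of `exp (α K)` dominates the norm of `W^{-(d / 2 - a), 2}(ℝ^d)` (`exists_negSobolevSq_le`).
That norm dominates the dual norm on `D` by the Cauchy-Schwarz inequality (`dualSobolevNorm_sq_le`). For
`α = β²` the order `d / 2 - a` is `(d - β²) / 2`.

*Existence.* The spectral density of `K` is nonnegative but not integrable. Divided by
`1 + (2π ξ i)²` for one coordinate `i`, it is integrable (`integrable_covSpectrum_mul`), and belongs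
to a Gaussian field `U` indexed by the points of `D`, constructed as an orthogonal series in
`L²(Ω × D)` (`exists_gaussian_field`). The field is `⟨X, ψ⟩ = ∫ U (ψ + ∂ᵢ ψ)`, where the operator
`1 + ∂ᵢ` multiplies the spectral density by `1 + (2π ξ i)²` and so restores `K`. The laws of the
variables `⟨X, ψ⟩` determine the rest: linearity makes them a Gaussian process, and polarization
gives its covariance.
-/

namespace LogCorrelated

/-! ### Quadratic forms of kernels in Fourier space -/

section QuadraticForm

variable {V : Type*} [NormedAddCommGroup V] [InnerProductSpace ℝ V] [FiniteDimensional ℝ V]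
  [MeasurableSpace V] [BorelSpace V]

lemma fourierInv_ofReal_eq_conj (f : V → ℝ) (ξ : V) :
    𝓕⁻ (fun x => (f x : ℂ)) ξ = starRingEnd ℂ (𝓕 (fun x => (f x : ℂ)) ξ) := by
  rw [Real.fourierInv_eq, Real.fourier_eq, ← integral_conj]
  congr 1 with x
  simp [Circle.smul_def, ← Circle.coe_inv_eq_conj, AddChar.map_neg_eq_inv]

lemma norm_fourierInv_ofReal (f : V → ℝ) (ξ : V) :
    ‖𝓕⁻ (fun x => (f x : ℂ)) ξ‖ = ‖𝓕 (fun x => (f x : ℂ)) ξ‖ := by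
  rw [fourierInv_ofReal_eq_conj, RCLike.norm_conj]

/-- Convolution with a Fourier transform is a Fourier multiplier. -/
lemma integral_mul_fourier_sub {f G : V → ℂ} (hf : Integrable f) (hG : Integrable G) (x : V) :
    ∫ y, f y * 𝓕 G (x - y) = 𝓕 (fun ξ => G ξ * 𝓕⁻ f ξ) x := by
  simp only [Real.fourier_eq, Real.fourierInv_eq, Circle.smul_def, smul_eq_mul]
  have h1 : ∀ y, f y * ∫ v, (Real.fourierChar (-inner ℝ v (x - y)) : ℂ) * G v
      = ∫ v, f y * ((Real.fourierChar (-inner ℝ v (x - y)) : ℂ) * G v) :=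
    fun y => (integral_const_mul _ _).symm
  have h2 : ∀ v, (Real.fourierChar (-inner ℝ v x) : ℂ) *
      (G v * ∫ y, (Real.fourierChar (inner ℝ y v) : ℂ) * f y)
      = ∫ y, (Real.fourierChar (-inner ℝ v x) : ℂ) *
        (G v * ((Real.fourierChar (inner ℝ y v) : ℂ) * f y)) := by
    intro v
    rw [← integral_const_mul, ← integral_const_mul]
  simp_rw [h1, h2]
  rw [integral_integral_swap]
  · congr 1 with v
    congr 1 with y
    have : (Real.fourierChar (-inner ℝ v (x - y)) : ℂ)
        = (Real.fourierChar (-inner ℝ v x) : ℂ) * (Real.fourierChar (inner ℝ y v) : ℂ) := by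
      rw [← Circle.coe_mul, ← AddChar.map_add_eq_mul, inner_sub_right, real_inner_comm v y]
      congr 2
      ring
    rw [this]
    ring
  · refine (hf.mul_prod hG).mono ?_ (Filter.Eventually.of_forall fun p => ?_)
    · have hc : Continuous fun p : V × V =>
          (Real.fourierChar (-inner ℝ p.2 (x - p.1)) : ℂ) :=
        continuous_subtype_val.comp (Real.continuous_fourierChar.comp (by fun_prop))
      exact hf.1.comp_fst.mul (hc.aestronglyMeasurable.mul hG.1.comp_snd)
    · simp only [Function.uncurry, norm_mul, Circle.norm_coe, one_mul, le_refl]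

/-- The quadratic form of a kernel `K(x - y)`, where `K` is the Fourier transform of `G`, is the
integral of `G` against the squared modulus of the Fourier transform. -/
lemma integral_integral_fourier_sub {f G : V → ℝ} (hf : Integrable f) (hG : Integrable G) :
    ∫ x, ∫ y, (f x : ℂ) * f y * 𝓕 (fun ξ => (G ξ : ℂ)) (x - y)
      = ((∫ ξ, G ξ * ‖𝓕 (fun x => (f x : ℂ)) ξ‖ ^ 2 : ℝ) : ℂ) := by
  have hfc : Integrable fun x => (f x : ℂ) := hf.ofReal
  have hGc : Integrable fun x => (G x : ℂ) := hG.ofReal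
  simp_rw [mul_assoc, integral_const_mul, integral_mul_fourier_sub hfc hGc]
  have hint : Integrable fun ξ => (G ξ : ℂ) * 𝓕⁻ (fun x => (f x : ℂ)) ξ := by
    refine hGc.mul_bdd (c := ∫ x, ‖(f x : ℂ)‖) ?_ (Filter.Eventually.of_forall fun ξ => ?_)
    · have : 𝓕⁻ (fun x => (f x : ℂ)) = fun ξ => 𝓕 (fun x => (f x : ℂ)) (-ξ) := by
        ext ξ; rw [Real.fourierInv_eq_fourier_neg]
      rw [this]
      have hc : Continuous (𝓕 fun x => (f x : ℂ)) :=
        VectorFourier.fourierIntegral_continuous Real.continuous_fourierChar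
          (by exact continuous_inner) hfc
      exact (hc.comp continuous_neg).aestronglyMeasurable
    · rw [Real.fourierInv_eq_fourier_neg]
      exact VectorFourier.norm_fourierIntegral_le_integral_norm _ _ _ _ _
  have hswap := VectorFourier.integral_fourierIntegral_smul_eq_flip (μ := volume) (ν := volume)
    (L := innerₗ V) Real.continuous_fourierChar (by exact continuous_inner) hfc hint
  rw [flip_innerₗ] at hswap
  simp only [smul_eq_mul] at hswap
  refine hswap.symm.trans ?_
  rw [← integral_complex_ofReal]
  congr 1 with ξ
  change 𝓕 (fun x => (f x : ℂ)) ξ * _ = _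
  rw [fourierInv_ofReal_eq_conj]
  push_cast
  rw [← Complex.mul_conj']
  ring

/-- The Fourier transform of `x ↦ exp (-t |x|²)`. -/
noncomputable def gaussianSpectrum (V : Type*) [NormedAddCommGroup V] [InnerProductSpace ℝ V]
    (t : ℝ) (ξ : V) : ℝ :=
  (Real.pi / t) ^ (Module.finrank ℝ V / 2 : ℝ) * Real.exp (-Real.pi ^ 2 * ‖ξ‖ ^ 2 / t)

omit [FiniteDimensional ℝ V] [MeasurableSpace V] [BorelSpace V] in
lemma gaussianSpectrum_nonneg {t : ℝ} (ht : 0 ≤ t) (ξ : V) : 0 ≤ gaussianSpectrum V t ξ := by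
  have := Real.pi_pos
  unfold gaussianSpectrum; positivity

lemma integrable_exp_neg_mul_sq_norm {b : ℝ} (hb : 0 < b) :
    Integrable fun v : V => Real.exp (-b * ‖v‖ ^ 2) := by
  have h :=
    (GaussianFourier.integrable_cexp_neg_mul_sq_norm_add (V := V) (b := b) (by simpa) 0 0).norm
  refine h.congr (Filter.Eventually.of_forall fun v => ?_)
  simp [Complex.norm_exp, ← Complex.ofReal_pow]

omit [FiniteDimensional ℝ V] [MeasurableSpace V] [BorelSpace V] in
lemma continuous_gaussianSpectrum (t : ℝ) : Continuous (gaussianSpectrum V t) := by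
  unfold gaussianSpectrum; fun_prop

lemma integrable_gaussianSpectrum {t : ℝ} (ht : 0 < t) : Integrable (gaussianSpectrum V t) := by
  have hb : 0 < Real.pi ^ 2 / t := by have := Real.pi_pos; positivity
  refine ((integrable_exp_neg_mul_sq_norm (V := V) hb).const_mul
    ((Real.pi / t) ^ (Module.finrank ℝ V / 2 : ℝ))).congr
    (Filter.Eventually.of_forall fun v => ?_)
  simp only [gaussianSpectrum]
  congr 2
  ring

lemma fourier_gaussianSpectrum {t : ℝ} (ht : 0 < t) (x : V) :
    𝓕 (fun ξ => (gaussianSpectrum V t ξ : ℂ)) x = (Real.exp (-t * ‖x‖ ^ 2) : ℂ) := by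
  have hpi := Real.pi_pos
  have hb : 0 < Real.pi ^ 2 / t := by positivity
  have h := fourier_gaussian_innerProductSpace (V := V) (b := ((Real.pi ^ 2 / t : ℝ) : ℂ))
    (by rwa [Complex.ofReal_re]) x
  have h2 : (fun ξ => (gaussianSpectrum V t ξ : ℂ)) =
      fun ξ => (((Real.pi / t) ^ (Module.finrank ℝ V / 2 : ℝ) : ℝ) : ℂ) •
        Complex.exp (-((Real.pi ^ 2 / t : ℝ) : ℂ) * ‖ξ‖ ^ 2) := by
    ext ξ
    simp only [gaussianSpectrum, smul_eq_mul]
    push_cast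
    congr 2
    ring
  have h3 : 𝓕 (fun ξ => (gaussianSpectrum V t ξ : ℂ)) x
      = (((Real.pi / t) ^ (Module.finrank ℝ V / 2 : ℝ) : ℝ) : ℂ) •
        𝓕 (fun v : V => Complex.exp (-((Real.pi ^ 2 / t : ℝ) : ℂ) * ‖v‖ ^ 2)) x := by
    rw [h2]
    exact congrFun (VectorFourier.fourierIntegral_const_smul _ _ _ _ _) x
  rw [h3, h]
  have h4 : ((Real.pi : ℂ) / ((Real.pi ^ 2 / t : ℝ) : ℂ)) ^ (Module.finrank ℝ V / 2 : ℂ)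
      = (((t / Real.pi) ^ (Module.finrank ℝ V / 2 : ℝ) : ℝ) : ℂ) := by
    rw [Complex.ofReal_cpow (by positivity)]
    push_cast
    congr 1
    field_simp
  rw [h4, smul_eq_mul, ← mul_assoc, ← Complex.ofReal_mul, ← Real.mul_rpow (by positivity)
    (by positivity)]
  have h5 : Real.pi / t * (t / Real.pi) = 1 := by field_simp
  rw [h5, Real.one_rpow, Complex.ofReal_one, one_mul, Complex.ofReal_exp]
  congr 1
  push_cast
  have : (Real.pi : ℂ) ≠ 0 := by exact_mod_cast hpi.ne'
  have : (t : ℂ) ≠ 0 := by exact_mod_cast ht.ne'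
  field_simp

/-- The quadratic form of a Gaussian kernel, computed in Fourier space. -/
lemma integral_integral_gaussian {f : V → ℝ} (hf : Integrable f) {t : ℝ} (ht : 0 < t) :
    ∫ x, ∫ y, f x * f y * Real.exp (-t * ‖x - y‖ ^ 2)
      = ∫ ξ, gaussianSpectrum V t ξ * ‖𝓕 (fun x => (f x : ℂ)) ξ‖ ^ 2 := by
  have h := integral_integral_fourier_sub hf (integrable_gaussianSpectrum (V := V) ht)
  simp_rw [fourier_gaussianSpectrum ht] at h
  rw [← Complex.ofReal_inj, ← h, ← integral_complex_ofReal]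
  congr 1 with x
  rw [← integral_complex_ofReal]
  congr 1 with y
  push_cast
  rfl

end QuadraticForm

/-! ### Binomial coefficients and Gaussian mixtures -/

lemma multichoose_eq_prod_div (a : ℝ) (n : ℕ) :
    Ring.multichoose a n = (∏ j ∈ Finset.range n, (a + j)) / n.factorial := by
  have h := Ring.factorial_nsmul_multichoose_eq_ascPochhammer a n
  have h2 : (ascPochhammer ℝ n).eval a = ∏ j ∈ Finset.range n, (a + j) := by
    clear h
    induction n with
    | zero => simp
    | succ n ih => rw [ascPochhammer_succ_eval, Finset.prod_range_succ, ih]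
  rw [Polynomial.ascPochhammer_smeval_eq_eval, nsmul_eq_mul, h2] at h
  rw [← h, mul_div_cancel_left₀]
  exact_mod_cast n.factorial_ne_zero

lemma multichoose_pos {a : ℝ} (ha : 0 < a) (n : ℕ) : 0 < Ring.multichoose a n := by
  rw [multichoose_eq_prod_div]
  exact div_pos (Finset.prod_pos fun j _ => by positivity) (by positivity)

/-- The binomial series of `(1 - x) ^ (-a)`, all of whose coefficients are positive. -/
lemma hasSum_multichoose (a : ℝ) {x : ℝ} (hx : |x| < 1) :
    HasSum (fun n => Ring.multichoose a n * x ^ n) ((1 - x) ^ (-a)) := by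
  have h := (Real.one_div_one_sub_rpow_hasFPowerSeriesOnBall_zero a).hasSum (y := x)
    (by simpa [enorm_eq_nnnorm, ← NNReal.coe_lt_coe] using hx)
  have hx' : 0 ≤ 1 - x := by linarith [(abs_lt.1 hx).2]
  simp only [zero_add, one_div, ← Real.rpow_neg hx'] at h
  simpa [FormalMultilinearSeries.ofScalars_apply_eq, ← Ring.multichoose_eq, mul_comm] using h

/-- Euler's limit formula for the Gamma function pins down the growth of the coefficients. -/
lemma exists_multichoose_bounds {a : ℝ} (ha : 0 < a) :
    ∃ m M : ℝ, 0 < m ∧ 0 < M ∧ ∀ n : ℕ, 1 ≤ n →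
      m * (n : ℝ) ^ (a - 1) ≤ Ring.multichoose a n ∧
      Ring.multichoose a n ≤ M * (n : ℝ) ^ (a - 1) := by
  have hlim := Real.GammaSeq_tendsto_Gamma a
  have hlim' := hlim.inv₀ (Real.Gamma_pos_of_pos ha).ne'
  obtain ⟨A, hA⟩ := hlim.bddAbove_range
  obtain ⟨B, hB⟩ := hlim'.bddAbove_range
  have hA' : ∀ n, Real.GammaSeq a n ≤ A := fun n => hA ⟨n, rfl⟩
  have hB' : ∀ n, (Real.GammaSeq a n)⁻¹ ≤ B := fun n => hB ⟨n, rfl⟩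
  have hpos : ∀ n : ℕ, 1 ≤ n → 0 < Real.GammaSeq a n := fun n hn => by
    have : (0 : ℝ) < n := by exact_mod_cast hn
    unfold Real.GammaSeq
    exact div_pos (by positivity) (Finset.prod_pos fun j _ => by positivity)
  have hA0 : 0 < A := (hpos 1 le_rfl).trans_le (hA' 1)
  have hB0 : 0 < B := (inv_pos.2 (hpos 1 le_rfl)).trans_le (hB' 1)
  have hc : ∀ n : ℕ, 1 ≤ n →
      Ring.multichoose a n = (Real.GammaSeq a n)⁻¹ * ((n : ℝ) ^ a / (a + n)) := by
    intro n hn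
    have hn' : (0 : ℝ) < n := by exact_mod_cast hn
    have hP : 0 < ∏ j ∈ Finset.range n, (a + (j : ℝ)) :=
      Finset.prod_pos fun j _ => by positivity
    have : 0 < (n : ℝ) ^ a := by positivity
    rw [multichoose_eq_prod_div, Real.GammaSeq, Finset.prod_range_succ]
    field_simp
  refine ⟨A⁻¹ * (a + 1)⁻¹, B, by positivity, hB0, fun n hn => ?_⟩
  have hn' : (1 : ℝ) ≤ n := by exact_mod_cast hn
  have hpow : (n : ℝ) ^ (a - 1) = (n : ℝ) ^ a / n := by
    rw [Real.rpow_sub (by linarith), Real.rpow_one]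
  rw [hc n hn, hpow]
  have h0 : 0 < (n : ℝ) ^ a := by positivity
  constructor
  · rw [mul_assoc]
    refine mul_le_mul (inv_anti₀ (hpos n hn) (hA' n)) ?_ (by positivity)
      (inv_pos.2 (hpos n hn)).le
    rw [← div_eq_inv_mul, div_div]
    refine div_le_div_of_nonneg_left h0.le (by positivity) ?_
    nlinarith
  · refine mul_le_mul (hB' n) ?_ (by positivity) hB0.le
    exact div_le_div_of_nonneg_left h0.le (by linarith) (by linarith)

/-- The Gaussian mixture with weights `multichoose a n` dominates the weight of the Sobolev space
of order `-(d / 2 - a)`: the terms with `n` comparable to `1 + |ξ|²` suffice. -/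
lemma exists_le_sum_multichoose_gaussianSpectrum {V : Type*} [NormedAddCommGroup V]
    [InnerProductSpace ℝ V] {a : ℝ} (ha : 0 < a) (ha' : a < Module.finrank ℝ V / 2) :
    ∃ c : ℝ, 0 < c ∧ ∀ ξ : V, ∃ s : Finset ℕ,
      c * (1 + ‖ξ‖ ^ 2) ^ (-(Module.finrank ℝ V / 2 - a) : ℝ)
        ≤ ∑ n ∈ s, Ring.multichoose a n * gaussianSpectrum V n ξ := by
  obtain ⟨m, M, hm, hM, hmM⟩ := exists_multichoose_bounds ha
  set δ : ℝ := Module.finrank ℝ V / 2 with hδ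
  have hpi := Real.pi_pos
  refine ⟨m * Real.pi ^ δ * Real.exp (-Real.pi ^ 2) * 4 ^ (a - 1 - δ), by positivity,
    fun ξ => ?_⟩
  -- the sum runs over `N ≤ n < 2 N`; all these terms are comparable to each other
  set N : ℕ := ⌈1 + ‖ξ‖ ^ 2⌉₊ with hN
  have hN1 : 1 + ‖ξ‖ ^ 2 ≤ N := Nat.le_ceil _
  have hN2 : (N : ℝ) ≤ 2 * (1 + ‖ξ‖ ^ 2) := by
    have := (Nat.ceil_lt_add_one (show 0 ≤ 1 + ‖ξ‖ ^ 2 by positivity)).le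
    nlinarith [sq_nonneg ‖ξ‖]
  have hNpos : (1 : ℝ) ≤ N := by nlinarith [sq_nonneg ‖ξ‖]
  have hNpos' : 1 ≤ N := by exact_mod_cast hNpos
  have hr : 0 < 1 + ‖ξ‖ ^ 2 := by positivity
  refine ⟨Finset.Ico N (2 * N), ?_⟩
  have key : ∀ n ∈ Finset.Ico N (2 * N),
      m * Real.pi ^ δ * Real.exp (-Real.pi ^ 2) * 4 ^ (a - 1 - δ) * (1 + ‖ξ‖ ^ 2) ^ (a - 1 - δ)
        ≤ Ring.multichoose a n * gaussianSpectrum V n ξ := by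
    intro n hn
    rw [Finset.mem_Ico] at hn
    have hn1 : 1 ≤ n := hNpos'.trans hn.1
    have hn0 : (0 : ℝ) < n := by exact_mod_cast hn1
    have hnN : (N : ℝ) ≤ n := by exact_mod_cast hn.1
    have hnN2 : (n : ℝ) ≤ 4 * (1 + ‖ξ‖ ^ 2) := by
      have : (n : ℝ) ≤ 2 * N := by exact_mod_cast hn.2.le
      linarith
    have e1 : Real.exp (-Real.pi ^ 2) ≤ Real.exp (-Real.pi ^ 2 * ‖ξ‖ ^ 2 / n) := by
      apply Real.exp_le_exp.2
      rw [neg_mul, neg_div, neg_le_neg_iff, div_le_iff₀ hn0]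
      nlinarith [sq_nonneg Real.pi]
    have e2 : (4 * (1 + ‖ξ‖ ^ 2)) ^ (a - 1 - δ) ≤ (n : ℝ) ^ (a - 1 - δ) :=
      Real.rpow_le_rpow_of_nonpos hn0 hnN2 (by linarith)
    have e3 : (Real.pi / n) ^ δ = Real.pi ^ δ * (n : ℝ) ^ (-δ) := by
      rw [Real.div_rpow hpi.le hn0.le, Real.rpow_neg hn0.le]; rfl
    have e4 : (n : ℝ) ^ (a - 1 - δ) = (n : ℝ) ^ (a - 1) * (n : ℝ) ^ (-δ) := by
      rw [← Real.rpow_add hn0]; rfl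
    calc _ = (m * Real.pi ^ δ) * (Real.exp (-Real.pi ^ 2) * (4 * (1 + ‖ξ‖ ^ 2)) ^ (a - 1 - δ)) := by
          rw [Real.mul_rpow (by norm_num) hr.le]; ring
      _ ≤ (m * Real.pi ^ δ) * (Real.exp (-Real.pi ^ 2 * ‖ξ‖ ^ 2 / n) * (n : ℝ) ^ (a - 1 - δ)) := by
          gcongr
      _ = (m * (n : ℝ) ^ (a - 1)) * gaussianSpectrum V n ξ := by
          rw [gaussianSpectrum, ← hδ, e3, e4]; ring
      _ ≤ _ := mul_le_mul_of_nonneg_right (hmM n hn1).1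
          (gaussianSpectrum_nonneg hn0.le ξ)
  have hsum := Finset.card_nsmul_le_sum _ _ _ key
  refine le_trans ?_ hsum
  rw [Nat.card_Ico, nsmul_eq_mul]
  have : ((2 * N - N : ℕ) : ℝ) = N := by congr 1; omega
  rw [this]
  have e5 : (1 + ‖ξ‖ ^ 2) ^ (-(δ - a)) = (1 + ‖ξ‖ ^ 2) * (1 + ‖ξ‖ ^ 2) ^ (a - 1 - δ) := by
    nth_rewrite 2 [← Real.rpow_one (1 + ‖ξ‖ ^ 2)]
    rw [← Real.rpow_add hr]; congr 1; ring
  rw [e5]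
  have : 0 ≤ m * Real.pi ^ δ * Real.exp (-Real.pi ^ 2) * 4 ^ (a - 1 - δ) *
    (1 + ‖ξ‖ ^ 2) ^ (a - 1 - δ) := by positivity
  nlinarith

/-! ### Series of Gaussian kernels -/

section Series

variable {V : Type*} [NormedAddCommGroup V] [InnerProductSpace ℝ V] [FiniteDimensional ℝ V]
  [MeasurableSpace V] [BorelSpace V]

lemma continuous_fourier {f : V → ℂ} (hf : Integrable f) : Continuous (𝓕 f) :=
  VectorFourier.fourierIntegral_continuous Real.continuous_fourierChar
    (by exact continuous_inner) hf

lemma norm_fourier_le (f : V → ℂ) (ξ : V) : ‖𝓕 f ξ‖ ≤ ∫ x, ‖f x‖ :=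
  VectorFourier.norm_fourierIntegral_le_integral_norm _ _ _ _ _

lemma integrable_mul_norm_fourier_sq {f : V → ℂ} (hf : Integrable f) {G : V → ℝ}
    (hG : Integrable G) : Integrable fun ξ => G ξ * ‖𝓕 f ξ‖ ^ 2 := by
  refine hG.mul_bdd (c := (∫ x, ‖f x‖) ^ 2)
    ((continuous_fourier hf).norm.pow 2).aestronglyMeasurable
    (Filter.Eventually.of_forall fun ξ => ?_)
  rw [norm_pow, norm_norm]
  gcongr
  exact norm_fourier_le f ξ

/-- Summation of the quadratic forms of Gaussian kernels. The sum of the kernels may be singular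
on the diagonal, as long as the weights decay fast enough for it to be locally integrable. -/
lemma hasSum_integral_integral_gaussian [Nontrivial V] {b : ℕ → ℝ} (hb : ∀ n, 0 ≤ b n)
    (hsum : Summable fun n : ℕ => b n * (n : ℝ) ^ (-(Module.finrank ℝ V / 2) : ℝ))
    {K : V → ℝ} (hK : ∀ x, x ≠ 0 →
      HasSum (fun n : ℕ => b n * Real.exp (-(n : ℝ) * ‖x‖ ^ 2)) (K x))
    {f : V → ℝ} (hf : Integrable f) {M : ℝ} (hM : ∀ x, |f x| ≤ M) :
    HasSum (fun n : ℕ => b n * ∫ x, ∫ y, f x * f y * Real.exp (-(n : ℝ) * ‖x - y‖ ^ 2))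
      (∫ x, ∫ y, f x * f y * K (x - y)) := by
  have hpi := Real.pi_pos
  set δ : ℝ := Module.finrank ℝ V / 2 with hδ
  have hM0 : 0 ≤ M := (abs_nonneg _).trans (hM 0)
  have hexp : ∀ (n : ℕ) (x : V), Real.exp (-(n : ℝ) * ‖x‖ ^ 2) ≤ 1 := fun n x => by
    rw [Real.exp_le_one_iff, neg_mul]
    have : 0 ≤ (n : ℝ) * ‖x‖ ^ 2 := by positivity
    linarith
  set β : ℕ → ℝ := fun n => M * Real.pi ^ δ * (n : ℝ) ^ (-δ) + if n = 0 then ∫ y, |f y| else 0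
    with hβ
  -- the two cases: for `n = 0` the kernel is constant, for `n ≥ 1` it has integral `(π / n) ^ δ`
  have hint : ∀ (n : ℕ) (x : V), Integrable fun y => f y * Real.exp (-(n : ℝ) * ‖x - y‖ ^ 2) :=
    fun n x => hf.mul_bdd (c := 1) (by fun_prop) (Filter.Eventually.of_forall fun y => by
      rw [Real.norm_of_nonneg (Real.exp_nonneg _)]; exact hexp n _)
  have hle : ∀ (n : ℕ) (x : V), ∫ y, |f y| * Real.exp (-(n : ℝ) * ‖x - y‖ ^ 2) ≤ β n := by
    intro n x
    rcases Nat.eq_zero_or_pos n with rfl | hn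
    · simp only [hβ, CharP.cast_eq_zero, neg_zero, zero_mul, Real.exp_zero, mul_one, if_true]
      have : 0 ≤ M * Real.pi ^ δ * (0 : ℝ) ^ (-δ) := by positivity
      linarith
    · have hn' : (0 : ℝ) < n := by exact_mod_cast hn
      simp only [hβ, hn.ne', if_false, add_zero]
      have hg : Integrable fun y : V => Real.exp (-(n : ℝ) * ‖x - y‖ ^ 2) :=
        (integrable_exp_neg_mul_sq_norm hn').comp_sub_left x
      calc ∫ y, |f y| * Real.exp (-(n : ℝ) * ‖x - y‖ ^ 2)
          ≤ ∫ y, M * Real.exp (-(n : ℝ) * ‖x - y‖ ^ 2) := by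
            refine integral_mono ?_ (hg.const_mul M) fun y => ?_
            · refine (hint n x).norm.congr (Filter.Eventually.of_forall fun y => ?_)
              simp [abs_of_nonneg (Real.exp_nonneg _)]
            · exact mul_le_mul_of_nonneg_right (hM y) (Real.exp_nonneg _)
        _ = M * (Real.pi / n) ^ δ := by
            rw [integral_const_mul,
              integral_sub_left_eq_self (fun y : V => Real.exp (-(n : ℝ) * ‖y‖ ^ 2)) volume x,
              GaussianFourier.integral_rexp_neg_mul_sq_norm hn']
        _ = M * Real.pi ^ δ * (n : ℝ) ^ (-δ) := by
            rw [Real.div_rpow hpi.le hn'.le, Real.rpow_neg hn'.le]; ring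
  have hβsum : Summable fun n => b n * β n := by
    have h1 := hsum.mul_left (M * Real.pi ^ δ)
    have h2 : Summable fun n : ℕ => if n = 0 then b 0 * ∫ y, |f y| else 0 :=
      (hasSum_ite_eq 0 _).summable
    refine (h1.add h2).congr fun n => ?_
    simp only [hβ]
    split_ifs with h
    · subst h; ring
    · ring
  have hnorm : ∀ (n : ℕ) (x : V),
      ∫ y, ‖f x * f y * (b n * Real.exp (-(n : ℝ) * ‖x - y‖ ^ 2))‖ ≤ |f x| * (b n * β n) := by
    intro n x
    have : ∀ y, ‖f x * f y * (b n * Real.exp (-(n : ℝ) * ‖x - y‖ ^ 2))‖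
        = |f x| * b n * (|f y| * Real.exp (-(n : ℝ) * ‖x - y‖ ^ 2)) := fun y => by
      simp only [norm_mul, Real.norm_eq_abs, abs_of_nonneg (hb n), Real.abs_exp]; ring
    simp_rw [this, integral_const_mul, mul_assoc]
    gcongr
    · exact hb n
    · exact hle n x
  have hinner : ∀ x, HasSum
      (fun n : ℕ => ∫ y, f x * f y * (b n * Real.exp (-(n : ℝ) * ‖x - y‖ ^ 2)))
      (∫ y, f x * f y * K (x - y)) := by
    intro x
    have h := hasSum_integral_of_summable_integral_norm (μ := volume)
      (F := fun (n : ℕ) y => f x * f y * (b n * Real.exp (-(n : ℝ) * ‖x - y‖ ^ 2)))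
      (fun n => (((hint n x).const_mul (f x * b n))).congr
        (Filter.Eventually.of_forall fun y => by ring))
      (Summable.of_nonneg_of_le (fun n => integral_nonneg fun y => norm_nonneg _)
        (fun n => hnorm n x) (hβsum.mul_left _))
    have e : ∫ y, f x * f y * K (x - y)
        = ∫ y, ∑' n : ℕ, f x * f y * (b n * Real.exp (-(n : ℝ) * ‖x - y‖ ^ 2)) := ?_
    · rw [e]
      exact h
    apply integral_congr_ae
    filter_upwards [(measure_eq_zero_iff_ae_notMem (μ := (volume : Measure V)) (s := {x})).1
      (measure_singleton x)] with y hy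
    have hxy : x - y ≠ 0 := fun h => hy (sub_eq_zero.1 h).symm
    exact ((hK _ hxy).mul_left (f x * f y)).tsum_eq.symm
  have hprod : ∀ n : ℕ, Integrable (Function.uncurry fun x y =>
      f x * f y * (b n * Real.exp (-(n : ℝ) * ‖x - y‖ ^ 2))) (volume.prod volume) := by
    intro n
    refine (hf.mul_prod hf).mul_bdd (c := b n) (by fun_prop)
      (Filter.Eventually.of_forall fun p => ?_)
    rw [Real.norm_of_nonneg (mul_nonneg (hb n) (Real.exp_nonneg _))]
    exact mul_le_of_le_one_right (hb n) (hexp n _)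
  have houter := hasSum_integral_of_summable_integral_norm (μ := volume)
    (F := fun (n : ℕ) x => ∫ y, f x * f y * (b n * Real.exp (-(n : ℝ) * ‖x - y‖ ^ 2)))
    (fun n => (hprod n).integral_prod_left)
    (by
      refine Summable.of_nonneg_of_le (fun n => integral_nonneg fun y => norm_nonneg _)
        (fun n => ?_) (hβsum.mul_left (∫ x, |f x|))
      rw [← integral_mul_const]
      refine integral_mono (hprod n).integral_prod_left.norm (hf.norm.mul_const _) fun x => ?_
      exact (norm_integral_le_integral_norm _).trans (hnorm n x))
  have e1 : (fun n : ℕ => b n * ∫ x, ∫ y, f x * f y * Real.exp (-(n : ℝ) * ‖x - y‖ ^ 2))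
      = fun n : ℕ => ∫ x, ∫ y, f x * f y * (b n * Real.exp (-(n : ℝ) * ‖x - y‖ ^ 2)) := by
    ext n
    rw [← integral_const_mul]
    congr 1 with x
    rw [← integral_const_mul]
    congr 1 with y
    ring
  have e2 : ∫ x, ∫ y, f x * f y * K (x - y)
      = ∫ x, ∑' n : ℕ, ∫ y, f x * f y * (b n * Real.exp (-(n : ℝ) * ‖x - y‖ ^ 2)) := by
    congr 1 with x
    exact (hinner x).tsum_eq.symm
  rw [e1, e2]
  exact houter

omit [MeasurableSpace V] [BorelSpace V] in
lemma gaussianSpectrum_zero [Nontrivial V] (ξ : V) : gaussianSpectrum V 0 ξ = 0 := by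
  have : (Module.finrank ℝ V / 2 : ℝ) ≠ 0 := by
    have : Module.finrank ℝ V ≠ 0 := Module.finrank_pos.ne'
    positivity
  simp [gaussianSpectrum, Real.zero_rpow this]

/-- Summation of the quadratic forms of Gaussian kernels, in Fourier space. A constant term of the
kernel has no counterpart there, so that only an inequality remains if `b 0 ≠ 0`. -/
lemma nonneg_and_lintegral_tsum_gaussianSpectrum [Nontrivial V] {b : ℕ → ℝ} (hb : ∀ n, 0 ≤ b n)
    {f : V → ℝ} (hf : Integrable f) {Q : ℝ}
    (hQ : HasSum (fun n : ℕ => b n * ∫ x, ∫ y, f x * f y * Real.exp (-(n : ℝ) * ‖x - y‖ ^ 2)) Q) :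
    0 ≤ Q ∧ ∫⁻ ξ, ∑' n : ℕ, ENNReal.ofReal (b n * gaussianSpectrum V n ξ *
        ‖𝓕 (fun x => (f x : ℂ)) ξ‖ ^ 2) ≤ ENNReal.ofReal Q ∧
    (b 0 = 0 → ∫⁻ ξ, ∑' n : ℕ, ENNReal.ofReal (b n * gaussianSpectrum V n ξ *
        ‖𝓕 (fun x => (f x : ℂ)) ξ‖ ^ 2) = ENNReal.ofReal Q) := by
  have hfc : Integrable fun x => (f x : ℂ) := hf.ofReal
  set T : ℕ → ℝ := fun n => b n * ∫ x, ∫ y, f x * f y * Real.exp (-(n : ℝ) * ‖x - y‖ ^ 2) with hT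
  have hpos : ∀ n : ℕ, 0 < n →
      ∫⁻ ξ, ENNReal.ofReal (b n * gaussianSpectrum V n ξ * ‖𝓕 (fun x => (f x : ℂ)) ξ‖ ^ 2)
        = ENNReal.ofReal (T n) := by
    intro n hn
    have hn' : (0 : ℝ) < n := by exact_mod_cast hn
    rw [hT]
    simp only
    rw [integral_integral_gaussian hf hn', ← integral_const_mul,
      ofReal_integral_eq_lintegral_ofReal]
    · simp_rw [mul_assoc]
    · exact (integrable_mul_norm_fourier_sq hfc (integrable_gaussianSpectrum hn')).const_mul _
    · exact Filter.Eventually.of_forall fun ξ => mul_nonneg (hb n)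
        (mul_nonneg (gaussianSpectrum_nonneg hn'.le ξ) (sq_nonneg _))
  have hzero : ∫⁻ ξ, ENNReal.ofReal (b 0 * gaussianSpectrum V ((0 : ℕ) : ℝ) ξ *
      ‖𝓕 (fun x => (f x : ℂ)) ξ‖ ^ 2) = 0 := by
    simp [gaussianSpectrum_zero]
  have hT0 : 0 ≤ T 0 := by
    simp only [hT, CharP.cast_eq_zero, neg_zero, zero_mul, Real.exp_zero, mul_one,
      integral_const_mul, integral_mul_const]
    exact mul_nonneg (hb 0) (mul_self_nonneg _)
  have hTn : ∀ n, 0 ≤ T n := by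
    intro n
    rcases Nat.eq_zero_or_pos n with rfl | hn
    · exact hT0
    · have hn' : (0 : ℝ) < n := by exact_mod_cast hn
      simp only [hT]
      rw [integral_integral_gaussian hf hn']
      exact mul_nonneg (hb n) (integral_nonneg fun ξ =>
        mul_nonneg (gaussianSpectrum_nonneg hn'.le ξ) (sq_nonneg _))
  have hmeas : ∀ n : ℕ, AEMeasurable fun ξ => ENNReal.ofReal (b n * gaussianSpectrum V n ξ *
      ‖𝓕 (fun x => (f x : ℂ)) ξ‖ ^ 2) := fun n =>
    ((continuous_const.mul (continuous_gaussianSpectrum _)).mul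
      ((continuous_fourier hfc).norm.pow 2)).measurable.ennreal_ofReal.aemeasurable
  refine ⟨hQ.nonneg hTn, ?_⟩
  rw [lintegral_tsum hmeas, ← hQ.tsum_eq, ENNReal.ofReal_tsum_of_nonneg hTn hQ.summable]
  constructor
  · refine ENNReal.tsum_le_tsum fun n => ?_
    rcases Nat.eq_zero_or_pos n with rfl | hn
    · rw [hzero]; exact zero_le
    · exact (hpos n hn).le
  · intro hb0
    congr 1 with n
    rcases Nat.eq_zero_or_pos n with rfl | hn
    · rw [hzero]; simp [hT, hb0]
    · exact hpos n hn

end Series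

/-! ### The logarithmic kernel -/

/-- The function `φ (r) = (1 - exp (-r)) / r`, extended by `φ (0) = 1`. -/
noncomputable def expQuotient (r : ℝ) : ℝ := dslope (fun t => 1 - Real.exp (-t)) 0 r

lemma expQuotient_of_ne {r : ℝ} (hr : r ≠ 0) : expQuotient r = (1 - Real.exp (-r)) / r := by
  rw [expQuotient, dslope_of_ne _ hr, slope_def_field]
  simp

lemma expQuotient_pos (r : ℝ) : 0 < expQuotient r := by
  rcases lt_trichotomy r 0 with hr | rfl | hr
  · rw [expQuotient_of_ne hr.ne]
    exact div_pos_of_neg_of_neg (by simpa using hr) hr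
  · have : HasDerivAt (fun t : ℝ => 1 - Real.exp (-t)) 1 0 := by
      simpa using ((hasDerivAt_neg (0 : ℝ)).exp.const_sub 1)
    rw [expQuotient, dslope_same, this.deriv]
    exact one_pos
  · rw [expQuotient_of_ne hr.ne']
    exact div_pos (by simpa using hr) hr

lemma contDiff_expQuotient : ContDiff ℝ (⊤ : ℕ∞) expQuotient := by
  rw [contDiff_iff_contDiffAt]
  intro r
  have hs : ContDiff ℝ (⊤ : ℕ∞) fun t : ℝ => 1 - Real.exp (-t) := by fun_prop
  by_cases hr : r = 0
  · subst hr
    have han : AnalyticAt ℝ (fun t : ℝ => 1 - Real.exp (-t)) 0 := by fun_prop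
    obtain ⟨p, hp⟩ := han
    exact (hp.has_fpower_series_dslope_fslope.analyticAt).contDiffAt
  · refine (hs.contDiffAt.div contDiffAt_id hr).congr_of_eventuallyEq ?_
    filter_upwards [isOpen_ne.mem_nhds hr] with t ht
    exact expQuotient_of_ne ht

/-- The stationary kernel `-(1/2) log (1 - exp (-|x|²))`, which behaves like `log (1 / |x|)` at
the origin. -/
noncomputable def logKernel {d : ℕ} (x : Rn d) : ℝ :=
  -(1 / 2) * Real.log (1 - Real.exp (-‖x‖ ^ 2))

/-- On a bounded set, the kernel `logKernel (z - y)` is of the form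
`log (1 / |z - y|) + h (z - y)` with `h` smooth and compactly supported. -/
lemma exists_covKernel_eq {d : ℕ} {D : Opens (Rn d)}
    (hD : Bornology.IsBounded (D : Set (Rn d))) :
    ∃ h : Rn d → ℝ, ContDiff ℝ (⊤ : ℕ∞) h ∧ HasCompactSupport h ∧
      ∀ y ∈ D, ∀ z ∈ D, y ≠ z → covKernel h y z = logKernel (z - y) := by
  obtain ⟨C, hC⟩ := hD.subset_closedBall (0 : Rn d)
  have hr : 0 < 2 * |C| + 1 := by positivity
  let χ : ContDiffBump (0 : Rn d) := ⟨2 * |C| + 1, 2 * |C| + 2, hr, by linarith⟩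
  refine ⟨fun x => χ x * (-(1 / 2) * Real.log (expQuotient (‖x‖ ^ 2))), ?_, ?_, ?_⟩
  · refine χ.contDiff.mul (contDiff_const.mul ?_)
    exact (contDiff_expQuotient.comp (contDiff_norm_sq ℝ)).log fun x => (expQuotient_pos _).ne'
  · exact χ.hasCompactSupport.mul_right
  · intro y hy z hz hyz
    have hnorm : 0 < ‖z - y‖ := norm_pos_iff.2 (sub_ne_zero.2 hyz.symm)
    have hyC : ‖y‖ ≤ |C| := by
      have := hC hy; rw [mem_closedBall_zero_iff] at this; exact this.trans (le_abs_self C)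
    have hzC : ‖z‖ ≤ |C| := by
      have := hC hz; rw [mem_closedBall_zero_iff] at this; exact this.trans (le_abs_self C)
    have hχ : χ (z - y) = 1 := by
      apply χ.one_of_mem_closedBall
      rw [mem_closedBall_zero_iff]
      have := norm_sub_le z y
      change ‖z - y‖ ≤ 2 * |C| + 1
      linarith
    have hsq : 0 < ‖z - y‖ ^ 2 := by positivity
    have h1 : 0 < 1 - Real.exp (-‖z - y‖ ^ 2) := by
      rw [sub_pos, Real.exp_lt_one_iff]; linarith
    rw [covKernel, logKernel, hχ, one_mul, expQuotient_of_ne hsq.ne', Real.log_div h1.ne' hsq.ne',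
      Real.log_pow, one_div, Real.log_inv]
    push_cast
    ring

/-- The covariance kernel as a mixture of Gaussians. -/
lemma hasSum_exp_div {r : ℝ} (hr : 0 < r) :
    HasSum (fun n : ℕ => ((n : ℝ)⁻¹ / 2) * Real.exp (-(n : ℝ) * r))
      (-(1 / 2) * Real.log (1 - Real.exp (-r))) := by
  have hx : |Real.exp (-r)| < 1 := by
    rw [Real.abs_exp, Real.exp_lt_one_iff]; linarith
  have h := (Real.hasSum_pow_div_log_of_abs_lt_one hx).mul_left (1 / 2)
  rw [← hasSum_nat_add_iff' 1]
  simp only [Finset.range_one, Finset.sum_singleton, CharP.cast_eq_zero, inv_zero, zero_div,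
    zero_mul, sub_zero]
  have e1 : (fun n : ℕ => (((n + 1 : ℕ) : ℝ)⁻¹ / 2) * Real.exp (-((n + 1 : ℕ) : ℝ) * r))
      = fun n : ℕ => 1 / 2 * (Real.exp (-r) ^ (n + 1) / ((n : ℝ) + 1)) := by
    ext n
    rw [← Real.exp_nat_mul, neg_mul, mul_neg]
    push_cast
    ring
  rw [e1, neg_mul, ← mul_neg]
  exact h

/-- The exponential of the covariance kernel as a mixture of Gaussians. -/
lemma hasSum_multichoose_exp (a : ℝ) {r : ℝ} (hr : 0 < r) :
    HasSum (fun n : ℕ => Ring.multichoose a n * Real.exp (-(n : ℝ) * r))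
      ((1 - Real.exp (-r)) ^ (-a)) := by
  have hx : |Real.exp (-r)| < 1 := by
    rw [Real.abs_exp, Real.exp_lt_one_iff]; linarith
  have e : (fun n : ℕ => Ring.multichoose a n * Real.exp (-(n : ℝ) * r))
      = fun n : ℕ => Ring.multichoose a n * Real.exp (-r) ^ n := by
    ext n
    rw [← Real.exp_nat_mul, neg_mul, mul_neg]
  rw [e]
  exact hasSum_multichoose a hx

/-! ### Dual Sobolev norm -/

/-- The square of the norm of `f` in `W^{-s,2}(ℝ^d)`. -/
noncomputable def negSobolevSq {d : ℕ} (s : ℝ) (f : Rn d → ℝ) : ℝ≥0∞ :=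
  ∫⁻ ξ, ENNReal.ofReal ((1 + ‖ξ‖ ^ 2) ^ (-s)) * ‖𝓕 (fun x => (f x : ℂ)) ξ‖ₑ ^ 2

lemma coe_toSchwartz {d : ℕ} {D : Opens (Rn d)} (ψ : 𝓓(D, ℝ)) :
    ⇑(toSchwartz ψ) = fun x => ((ψ x : ℝ) : ℂ) := rfl

lemma enorm_fourierInv_toSchwartz {d : ℕ} {D : Opens (Rn d)} (ψ : 𝓓(D, ℝ)) (ξ : Rn d) :
    ‖(𝓕⁻ (toSchwartz ψ)) ξ‖ₑ = ‖𝓕 (fun x => ((ψ x : ℝ) : ℂ)) ξ‖ₑ := by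
  rw [SchwartzMap.fourierInv_coe, coe_toSchwartz, ← ofReal_norm, ← ofReal_norm,
    norm_fourierInv_ofReal]

lemma negSobolevSq_lt_top {d : ℕ} {D : Opens (Rn d)} {s : ℝ} (hs : 0 ≤ s) (ψ : 𝓓(D, ℝ)) :
    negSobolevSq s ψ < ∞ := by
  have h := ((𝓕 (toSchwartz ψ)).memLp 2 (μ := volume)).integrable_norm_pow (by norm_num)
  refine lt_of_le_of_lt (lintegral_mono fun ξ => ?_) h.2
  have h1 : (1 + ‖ξ‖ ^ 2) ^ (-s) ≤ 1 :=
    Real.rpow_le_one_of_one_le_of_nonpos (by nlinarith [sq_nonneg ‖ξ‖]) (by linarith)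
  calc _ ≤ 1 * ‖𝓕 (fun x => ((ψ x : ℝ) : ℂ)) ξ‖ₑ ^ 2 := by
        gcongr
        exact ENNReal.ofReal_le_one.2 h1
    _ = _ := by
        rw [one_mul, enorm_pow, enorm_norm, SchwartzMap.fourier_coe, coe_toSchwartz]

/-- The pairing of `W^{s,2}` with `W^{-s,2}`, by the Cauchy-Schwarz inequality in Fourier space. -/
lemma enorm_integral_mul_le {d : ℕ} (s : ℝ) (φ : 𝓢(Rn d, ℂ)) {u : Rn d → ℂ}
    (hu : LocallyIntegrable u volume) :
    ‖∫ ξ, φ ξ * u ξ‖ₑ ≤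
      (∫⁻ ξ, ENNReal.ofReal ((1 + ‖ξ‖ ^ 2) ^ (-s)) * ‖φ ξ‖ₑ ^ 2) ^ (1 / 2 : ℝ) *
      (∫⁻ ξ, ENNReal.ofReal ((1 + ‖ξ‖ ^ 2) ^ s) * ‖u ξ‖ₑ ^ 2) ^ (1 / 2 : ℝ) := by
  have hw : ∀ ξ : Rn d, 0 < 1 + ‖ξ‖ ^ 2 := fun ξ => by positivity
  have hsq : ∀ (t : ℝ) (ξ : Rn d), ENNReal.ofReal ((1 + ‖ξ‖ ^ 2) ^ t)
      = ENNReal.ofReal ((1 + ‖ξ‖ ^ 2) ^ (t / 2)) ^ (2 : ℝ) := fun t ξ => by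
    have h2 : (1 + ‖ξ‖ ^ 2) ^ t = ((1 + ‖ξ‖ ^ 2) ^ (t / 2)) ^ 2 := by
      rw [← Real.rpow_mul_natCast (hw ξ).le]
      congr 1
      push_cast
      ring
    rw [ENNReal.rpow_two, ← ENNReal.ofReal_pow (by have := hw ξ; positivity), ← h2]
  have hone : ∀ ξ : Rn d, ENNReal.ofReal ((1 + ‖ξ‖ ^ 2) ^ (-s / 2)) *
      ENNReal.ofReal ((1 + ‖ξ‖ ^ 2) ^ (s / 2)) = 1 := fun ξ => by
    have h0 : -s / 2 + s / 2 = 0 := by ring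
    rw [← ENNReal.ofReal_mul (by have := hw ξ; positivity), ← Real.rpow_add (hw ξ), h0,
      Real.rpow_zero, ENNReal.ofReal_one]
  have hcont : ∀ t : ℝ, Continuous fun ξ : Rn d => (1 + ‖ξ‖ ^ 2) ^ t := fun t =>
    Continuous.rpow_const (by fun_prop) fun ξ => Or.inl (hw ξ).ne'
  have hF : AEMeasurable fun ξ : Rn d => ENNReal.ofReal ((1 + ‖ξ‖ ^ 2) ^ (-s / 2)) *
      ‖φ ξ‖ₑ :=
    ((hcont _).measurable.ennreal_ofReal.mul
      φ.continuous.measurable.enorm).aemeasurable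
  have hG : AEMeasurable fun ξ : Rn d => ENNReal.ofReal ((1 + ‖ξ‖ ^ 2) ^ (s / 2)) * ‖u ξ‖ₑ :=
    (hcont _).measurable.ennreal_ofReal.aemeasurable.mul hu.aestronglyMeasurable.enorm
  calc ‖∫ ξ, φ ξ * u ξ‖ₑ
      ≤ ∫⁻ ξ, ‖φ ξ * u ξ‖ₑ := enorm_integral_le_lintegral_enorm _
    _ = ∫⁻ ξ, ((fun ξ : Rn d => ENNReal.ofReal ((1 + ‖ξ‖ ^ 2) ^ (-s / 2)) *
          ‖φ ξ‖ₑ) *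
          fun ξ : Rn d => ENNReal.ofReal ((1 + ‖ξ‖ ^ 2) ^ (s / 2)) * ‖u ξ‖ₑ) ξ := by
        refine lintegral_congr fun ξ => ?_
        rw [Pi.mul_apply, mul_mul_mul_comm, hone, one_mul, enorm_mul]
    _ ≤ _ := ENNReal.lintegral_mul_le_Lp_mul_Lq _ Real.HolderConjugate.two_two hF hG
    _ = _ := by
        congr 2
        · refine lintegral_congr fun ξ => ?_
          rw [ENNReal.mul_rpow_of_nonneg _ _ zero_le_two, ← hsq, ENNReal.rpow_two]
        · refine lintegral_congr fun ξ => ?_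
          rw [ENNReal.mul_rpow_of_nonneg _ _ zero_le_two, ← hsq, ENNReal.rpow_two]

lemma enorm_apply_toSchwartz_le {d : ℕ} {D : Opens (Rn d)} (s : ℝ) (ψ : 𝓓(D, ℝ))
    {g : 𝓢'(Rn d, ℂ)} {u : Rn d → ℂ} (hu : HasFourierFunction g u) :
    ‖g (toSchwartz ψ)‖ₑ ≤ negSobolevSq s ψ ^ (1 / 2 : ℝ) *
      (∫⁻ ξ, ENNReal.ofReal ((1 + ‖ξ‖ ^ 2) ^ s) * ‖u ξ‖ₑ ^ 2) ^ (1 / 2 : ℝ) := by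
  obtain ⟨φ, hφ⟩ : ∃ φ : 𝓢(Rn d, ℂ), φ = 𝓕⁻ (toSchwartz ψ) := ⟨_, rfl⟩
  have h1 : toSchwartz ψ = 𝓕 φ := by rw [hφ, FourierInvPair.fourier_fourierInv_eq]
  have h2 : negSobolevSq s ψ
      = ∫⁻ ξ, ENNReal.ofReal ((1 + ‖ξ‖ ^ 2) ^ (-s)) * ‖φ ξ‖ₑ ^ 2 := by
    refine lintegral_congr fun ξ => ?_
    rw [hφ, enorm_fourierInv_toSchwartz]
  rw [h1, ← TemperedDistribution.fourier_apply, hu.2, h2]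
  exact enorm_integral_mul_le s φ hu.1

lemma dualSobolevNorm_sq_le {d : ℕ} {D : Opens (Rn d)} (s : ℝ) (ψ : 𝓓(D, ℝ)) :
    dualSobolevNorm s ψ ^ 2 ≤ 4 * negSobolevSq s ψ := by
  have h : dualSobolevNorm s ψ ≤ negSobolevSq s ψ ^ (1 / 2 : ℝ) * 2 := by
    refine iSup₂_le fun f hf => ?_
    -- the infima need not be attained, so that an extension of norm at most `1` may not exist
    have hf2 : sobolevNormOn s f < 2 := hf.trans_lt (by norm_num)
    simp only [sobolevNormOn, sobolevNorm, iInf_lt_iff] at hf2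
    obtain ⟨g, hg, u, hu, hlt⟩ := hf2
    rw [hg ψ]
    exact (enorm_apply_toSchwartz_le s ψ hu).trans (by gcongr)
  calc dualSobolevNorm s ψ ^ 2 ≤ (negSobolevSq s ψ ^ (1 / 2 : ℝ) * 2) ^ 2 := by gcongr
    _ = 4 * negSobolevSq s ψ := by
      rw [mul_pow, ← ENNReal.rpow_natCast, ← ENNReal.rpow_mul]
      norm_num
      ring

/-! ### Test functions and non-degeneracy -/

lemma apply_eq_zero_of_notMem {d : ℕ} {D : Opens (Rn d)} (ψ : 𝓓(D, ℝ)) {x : Rn d} (hx : x ∉ D) :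
    ψ x = 0 :=
  image_eq_zero_of_notMem_tsupport fun h => hx (ψ.tsupport_subset h)

lemma integrable_testFunction {d : ℕ} {D : Opens (Rn d)} (ψ : 𝓓(D, ℝ)) : Integrable ψ :=
  ψ.continuous.integrable_of_hasCompactSupport ψ.hasCompactSupport

lemma exists_abs_testFunction_le {d : ℕ} {D : Opens (Rn d)} (ψ : 𝓓(D, ℝ)) :
    ∃ M, ∀ x, |ψ x| ≤ M :=
  ψ.continuous.bounded_above_of_compact_support ψ.hasCompactSupport

/-- The diagonal, where a singular kernel takes a junk value, does not contribute. -/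
lemma setIntegral_kernel_eq {d : ℕ} [Nontrivial (Rn d)] {D : Opens (Rn d)} (ψ₁ ψ₂ : 𝓓(D, ℝ))
    {k : Rn d → Rn d → ℝ} {K : Rn d → ℝ}
    (hk : ∀ x ∈ D, ∀ y ∈ D, x ≠ y → k x y = K (x - y)) :
    ∫ x in (D : Set (Rn d)), ∫ y in (D : Set (Rn d)), k x y * ψ₁ x * ψ₂ y
      = ∫ x, ∫ y, ψ₁ x * ψ₂ y * K (x - y) := by
  rw [← setIntegral_eq_integral_of_forall_compl_eq_zero (s := (D : Set (Rn d)))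
    (f := fun x => ∫ y, ψ₁ x * ψ₂ y * K (x - y))
    (fun x hx => by simp [apply_eq_zero_of_notMem ψ₁ hx])]
  refine setIntegral_congr_fun D.isOpen.measurableSet fun x hx => ?_
  rw [← setIntegral_eq_integral_of_forall_compl_eq_zero (s := (D : Set (Rn d)))
    (f := fun y => ψ₁ x * ψ₂ y * K (x - y))
    (fun y hy => by simp [apply_eq_zero_of_notMem ψ₂ hy])]
  refine setIntegral_congr_ae D.isOpen.measurableSet ?_
  filter_upwards [(measure_eq_zero_iff_ae_notMem (μ := (volume : Measure (Rn d))) (s := {x})).1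
    (measure_singleton x)] with y hy hyD
  rw [hk x hx y hyD fun h => hy h.symm]
  ring

lemma summable_multichoose_mul_rpow {a δ : ℝ} (ha : 0 < a) (hδ : a < δ) :
    Summable fun n : ℕ => Ring.multichoose a n * (n : ℝ) ^ (-δ) := by
  obtain ⟨m, M, -, -, hmM⟩ := exists_multichoose_bounds ha
  have h : Summable fun n : ℕ => M * (n : ℝ) ^ (a - 1 - δ) :=
    (Real.summable_nat_rpow.2 (by linarith)).mul_left M
  refine Summable.of_norm_bounded_eventually_nat h ?_
  filter_upwards [Filter.eventually_ge_atTop 1] with n hn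
  have hn' : (0 : ℝ) < n := by exact_mod_cast hn
  rw [Real.norm_of_nonneg (mul_nonneg (multichoose_pos ha n).le (by positivity)),
    sub_eq_add_neg _ δ, Real.rpow_add hn', ← mul_assoc]
  exact mul_le_mul_of_nonneg_right (hmM n hn).2 (by positivity)

lemma summable_inv_mul_rpow {δ : ℝ} (hδ : 0 < δ) :
    Summable fun n : ℕ => (n : ℝ)⁻¹ / 2 * (n : ℝ) ^ (-δ) := by
  have h : Summable fun n : ℕ => 1 / 2 * (n : ℝ) ^ (-1 - δ) :=
    (Real.summable_nat_rpow.2 (by linarith)).mul_left _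
  refine Summable.of_norm_bounded_eventually_nat h ?_
  filter_upwards [Filter.eventually_ge_atTop 1] with n hn
  have hn' : (0 : ℝ) < n := by exact_mod_cast hn
  rw [Real.norm_of_nonneg (by positivity), sub_eq_add_neg, Real.rpow_add hn', Real.rpow_neg_one]
  exact le_of_eq (by ring)

/-- Comparison of the quadratic form of `(1 - exp (-|x|²)) ^ (-a)` with the norm of
`W^{-s,2}(ℝ^d)`, where `s = d / 2 - a`. -/
lemma exists_negSobolevSq_le {d : ℕ} [Nontrivial (Rn d)] {a : ℝ} (ha : 0 < a)
    (ha' : a < (d : ℝ) / 2) :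
    ∃ c : ℝ, 0 < c ∧ ∀ f : Rn d → ℝ, Integrable f → (∃ M, ∀ x, |f x| ≤ M) →
      0 ≤ ∫ x, ∫ y, f x * f y * (1 - Real.exp (-‖x - y‖ ^ 2)) ^ (-a) ∧
      ENNReal.ofReal c * negSobolevSq ((d : ℝ) / 2 - a) f ≤
        ENNReal.ofReal (∫ x, ∫ y, f x * f y * (1 - Real.exp (-‖x - y‖ ^ 2)) ^ (-a)) := by
  have hfin : Module.finrank ℝ (Rn d) = d := finrank_euclideanSpace_fin
  obtain ⟨c, hc, hcs⟩ := exists_le_sum_multichoose_gaussianSpectrum (V := Rn d) ha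
    (by rwa [hfin])
  refine ⟨c, hc, fun f hf ⟨M, hM⟩ => ?_⟩
  have hb : ∀ n, 0 ≤ Ring.multichoose a n := fun n => (multichoose_pos ha n).le
  have hQ := hasSum_integral_integral_gaussian (V := Rn d) hb
    (by rw [hfin]; exact summable_multichoose_mul_rpow ha ha')
    (K := fun x => (1 - Real.exp (-‖x‖ ^ 2)) ^ (-a))
    (fun x hx => hasSum_multichoose_exp a (by positivity)) hf hM
  obtain ⟨h0, h1, -⟩ := nonneg_and_lintegral_tsum_gaussianSpectrum hb hf hQ
  refine ⟨h0, le_trans ?_ h1⟩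
  rw [negSobolevSq, ← lintegral_const_mul' _ _ ENNReal.ofReal_ne_top]
  refine lintegral_mono fun ξ => ?_
  obtain ⟨s, hs⟩ := hcs ξ
  rw [hfin] at hs
  have h2 : ‖𝓕 (fun x => (f x : ℂ)) ξ‖ₑ ^ 2
      = ENNReal.ofReal (‖𝓕 (fun x => (f x : ℂ)) ξ‖ ^ 2) := by
    rw [← ofReal_norm, ENNReal.ofReal_pow (norm_nonneg _)]
  rw [h2, ← mul_assoc, ← ENNReal.ofReal_mul hc.le, ← ENNReal.ofReal_mul (by positivity)]
  refine (ENNReal.ofReal_le_ofReal (mul_le_mul_of_nonneg_right hs (sq_nonneg _))).trans ?_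
  rw [Finset.sum_mul, ENNReal.ofReal_sum_of_nonneg fun n _ => mul_nonneg
    (mul_nonneg (hb n) (gaussianSpectrum_nonneg (by positivity) _)) (sq_nonneg _)]
  exact ENNReal.sum_le_tsum s

/-- The lower bound in the definition of non-degeneracy, when the covariance kernel
equals `logKernel (z - y)` on `D`. -/
lemma exists_dualSobolevNorm_le {d : ℕ} [Nontrivial (Rn d)] {D : Opens (Rn d)} {h : Rn d → ℝ}
    (hh : ∀ y ∈ D, ∀ z ∈ D, y ≠ z → covKernel h y z = logKernel (z - y))
    {β : ℝ} (hβ : 0 < β) (hβd : β < Real.sqrt d) :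
    ∃ c₀ : ℝ, 0 < c₀ ∧ ∀ ψ : 𝓓(D, ℝ),
      dualSobolevNorm (((d : ℝ) - β ^ 2) / 2) ψ < ∞ ∧
      c₀ * (dualSobolevNorm (((d : ℝ) - β ^ 2) / 2) ψ).toReal ^ 2
        ≤ ∫ z in (D : Set (Rn d)), ψ z * opG D h (β ^ 2) ψ z := by
  have hβ2 : β ^ 2 < d := (Real.lt_sqrt hβ.le).1 hβd
  obtain ⟨c, hc, hcf⟩ := exists_negSobolevSq_le (d := d) (a := β ^ 2 / 2) (by positivity)
    (by linarith)
  have hs : (d : ℝ) / 2 - β ^ 2 / 2 = ((d : ℝ) - β ^ 2) / 2 := by ring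
  rw [hs] at hcf
  refine ⟨c / 4, by positivity, fun ψ => ?_⟩
  obtain ⟨h0, h1⟩ := hcf ψ (integrable_testFunction ψ) (exists_abs_testFunction_le ψ)
  have hform : ∫ z in (D : Set (Rn d)), ψ z * opG D h (β ^ 2) ψ z
      = ∫ x, ∫ y, ψ x * ψ y * (1 - Real.exp (-‖x - y‖ ^ 2)) ^ (-(β ^ 2 / 2)) := by
    rw [← setIntegral_kernel_eq ψ ψ (k := fun x y => Real.exp (β ^ 2 * covKernel h x y))
      (K := fun x => (1 - Real.exp (-‖x‖ ^ 2)) ^ (-(β ^ 2 / 2)))]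
    · congr 1 with x
      rw [opG, ← integral_const_mul]
      congr 1 with y
      ring
    · intro x hx y hy hxy
      have hpos : 0 < 1 - Real.exp (-‖x - y‖ ^ 2) := by
        have : 0 < ‖x - y‖ := norm_pos_iff.2 (sub_ne_zero.2 hxy)
        rw [sub_pos, Real.exp_lt_one_iff]
        nlinarith
      rw [hh x hx y hy hxy, logKernel, norm_sub_rev, Real.rpow_def_of_pos hpos]
      congr 1
      ring
  have h2 := dualSobolevNorm_sq_le (((d : ℝ) - β ^ 2) / 2) ψ
  have hfin : dualSobolevNorm (((d : ℝ) - β ^ 2) / 2) ψ < ∞ := by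
    have h3 : dualSobolevNorm (((d : ℝ) - β ^ 2) / 2) ψ ^ 2 < ∞ :=
      h2.trans_lt (ENNReal.mul_lt_top (by norm_num) (negSobolevSq_lt_top (by linarith) ψ))
    exact (ENNReal.pow_lt_top_iff.1 h3).resolve_right (by norm_num)
  refine ⟨hfin, ?_⟩
  rw [hform, ← ENNReal.ofReal_le_ofReal_iff h0]
  refine le_trans ?_ h1
  rw [ENNReal.ofReal_mul (by positivity), ← ENNReal.toReal_pow, ENNReal.ofReal_toReal
    (ENNReal.pow_lt_top hfin).ne]
  calc ENNReal.ofReal (c / 4) * dualSobolevNorm (((d : ℝ) - β ^ 2) / 2) ψ ^ 2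
      ≤ ENNReal.ofReal (c / 4) * (4 * negSobolevSq (((d : ℝ) - β ^ 2) / 2) ψ) := by gcongr
    _ = ENNReal.ofReal c * negSobolevSq (((d : ℝ) - β ^ 2) / 2) ψ := by
      rw [← mul_assoc]
      congr 1
      rw [show (4 : ℝ≥0∞) = ENNReal.ofReal 4 by norm_num, ← ENNReal.ofReal_mul (by positivity)]
      congr 1
      ring

/-! ### Gaussian fields as orthogonal series -/

/-- A family of pairwise orthogonal vectors with summable squared norms is summable. -/
lemma summable_of_pairwise_orthogonal {ι E : Type*} [NormedAddCommGroup E] [InnerProductSpace ℝ E]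
    [CompleteSpace E] {G : ι → E} (horth : ∀ i j, i ≠ j → inner ℝ (G i) (G j) = 0)
    (hsum : Summable fun i => ‖G i‖ ^ 2) : Summable G := by
  have hnorm : ∀ t : Finset ι, ‖∑ i ∈ t, G i‖ ^ 2 = ∑ i ∈ t, ‖G i‖ ^ 2 := by
    intro t
    rw [← real_inner_self_eq_norm_sq, sum_inner]
    refine Finset.sum_congr rfl fun i hi => ?_
    rw [inner_sum, Finset.sum_eq_single i (fun j _ hj => horth i j hj.symm)
      (fun h => absurd hi h), real_inner_self_eq_norm_sq]
  rw [summable_iff_vanishing_norm] at hsum ⊢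
  intro ε hε
  obtain ⟨s, hs⟩ := hsum (ε ^ 2) (by positivity)
  refine ⟨s, fun t ht => ?_⟩
  have h := hs t ht
  rw [← hnorm, Real.norm_of_nonneg (sq_nonneg _)] at h
  exact lt_of_pow_lt_pow_left₀ 2 hε.le h

/-- The law of a family of independent standard Gaussian variables. -/
noncomputable abbrev gaussianProduct (ι : Type*) : Measure (ι → ℝ) :=
  Measure.infinitePi fun _ : ι => gaussianReal 0 1

section GaussianProduct

variable {ι : Type*}

lemma map_coord (i : ι) :
    (gaussianProduct ι).map (fun ω => ω i) = gaussianReal 0 1 :=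
  Measure.infinitePi_map_eval _ i

lemma iIndepFun_coord : iIndepFun (fun (i : ι) (ω : ι → ℝ) => ω i) (gaussianProduct ι) :=
  iIndepFun_infinitePi (P := fun _ : ι => gaussianReal 0 1) (X := fun _ x => x)
    fun _ => measurable_id

lemma memLp_coord (i : ι) : MemLp (fun ω : ι → ℝ => ω i) 2 (gaussianProduct ι) := by
  have h : MemLp id 2 ((gaussianProduct ι).map (fun ω => ω i)) := by
    rw [map_coord]; exact memLp_id_gaussianReal 2
  exact (memLp_map_measure_iff h.1 (measurable_pi_apply i).aemeasurable).1 h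

lemma integral_coord (i : ι) : ∫ ω, ω i ∂gaussianProduct ι = 0 := by
  have h : ∫ x, x ∂((gaussianProduct ι).map (fun ω => ω i)) = 0 := by
    rw [map_coord]; exact integral_id_gaussianReal
  exact (integral_map (φ := fun ω : ι → ℝ => ω i) (f := fun x : ℝ => x)
    (measurable_pi_apply i).aemeasurable (by fun_prop)).symm.trans h

lemma integral_coord_sq (i : ι) : ∫ ω, ω i * ω i ∂gaussianProduct ι = 1 := by
  have h1 : ∫ x, x * x ∂(gaussianReal 0 1) = 1 := by
    have h := variance_id_gaussianReal (μ := 0) (v := 1)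
    rw [variance_eq_sub (memLp_id_gaussianReal 2)] at h
    simpa [pow_two] using h
  have h : ∫ x, x * x ∂((gaussianProduct ι).map (fun ω => ω i)) = 1 := by
    rw [map_coord, h1]
  rwa [integral_map (measurable_pi_apply i).aemeasurable (by fun_prop)] at h

lemma integral_coord_mul {i j : ι} (hij : i ≠ j) : ∫ ω, ω i * ω j ∂gaussianProduct ι = 0 := by
  have h := (iIndepFun_coord.indepFun hij).integral_fun_mul_eq_mul_integral
    (memLp_coord i).1 (memLp_coord j).1
  simpa [integral_coord] using h

/-- A finite linear combination of independent standard Gaussian variables is Gaussian. -/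
lemma charFun_map_sum_coord (s : Finset ι) (a : ι → ℝ) (t : ℝ) :
    charFun ((gaussianProduct ι).map fun ω => ∑ i ∈ s, ω i * a i) t
      = Complex.exp (-(t ^ 2 * ∑ i ∈ s, a i ^ 2 : ℝ) / 2) := by
  have hind : iIndepFun (fun (i : ι) (ω : ι → ℝ) => ω i * a i) (gaussianProduct ι) :=
    iIndepFun_coord.comp (fun i x => x * a i) fun i => by fun_prop
  rw [(hind.restrict s).charFun_map_fun_finsetSum_eq_prod
    fun i _ => Measurable.aemeasurable (by fun_prop)]
  simp only [Finset.prod_apply]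
  have h : ∀ i, charFun ((gaussianProduct ι).map fun ω => ω i * a i) t
      = Complex.exp (-(t ^ 2 * a i ^ 2 : ℝ) / 2) := by
    intro i
    have : (fun ω : ι → ℝ => ω i * a i) = (fun x => a i * x) ∘ fun ω => ω i := by
      ext ω; simp [mul_comm]
    rw [this, ← Measure.map_map (by fun_prop) (by fun_prop), map_coord,
      gaussianReal_map_const_mul, charFun_gaussianReal]
    congr 1
    simp
    ring
  simp_rw [h, ← Complex.exp_sum]
  congr 1
  rw [Finset.mul_sum]
  push_cast
  rw [← Finset.sum_div, Finset.sum_neg_distrib]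

end GaussianProduct

/-- Convergence in mean identifies a limit of Gaussian variables. -/
lemma map_eq_gaussianReal_of_tendsto {Ω ι : Type*} [MeasurableSpace Ω] {P : Measure Ω}
    [IsProbabilityMeasure P] {l : Filter ι} [l.NeBot] {S : ι → Ω → ℝ} {Y : Ω → ℝ} {σ : ι → ℝ}
    {v : ℝ}
    (hv : 0 ≤ v) (hS : ∀ i, AEMeasurable (S i) P) (hY : AEMeasurable Y P)
    (hcf : ∀ i t, charFun (P.map (S i)) t = Complex.exp (-(t ^ 2 * σ i : ℝ) / 2))
    (hσ : Filter.Tendsto σ l (nhds v))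
    (hint : ∀ i, Integrable (fun ω => Y ω - S i ω) P)
    (hlim : Filter.Tendsto (fun i => ∫ ω, |Y ω - S i ω| ∂P) l (nhds 0)) :
    P.map Y = gaussianReal 0 v.toNNReal := by
  have : IsProbabilityMeasure (P.map Y) := Measure.isProbabilityMeasure_map hY
  apply Measure.ext_of_charFun
  ext t
  rw [charFun_gaussianReal, Real.coe_toNNReal v hv]
  have hexp : ∀ (Z : Ω → ℝ), AEMeasurable Z P →
      charFun (P.map Z) t = ∫ ω, Complex.exp (t * Z ω * Complex.I) ∂P := by
    intro Z hZ
    rw [charFun_apply_real, integral_map hZ (by fun_prop)]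
  have h1 : Filter.Tendsto (fun i => charFun (P.map (S i)) t) l (nhds (charFun (P.map Y) t)) := by
    rw [tendsto_iff_norm_sub_tendsto_zero]
    have hlim' := hlim.const_mul |t|
    rw [mul_zero] at hlim'
    refine squeeze_zero (fun i => norm_nonneg _) (fun i => ?_) hlim'
    have hi : ∀ (Z : Ω → ℝ), AEMeasurable Z P →
        Integrable (fun ω => Complex.exp (t * Z ω * Complex.I)) P := fun Z hZ => by
      refine Integrable.of_bound (C := 1) ?_ (Filter.Eventually.of_forall fun ω => ?_)
      · exact AEMeasurable.aestronglyMeasurable (by fun_prop)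
      · rw [← Complex.ofReal_mul, Complex.norm_exp_ofReal_mul_I]
    rw [hexp _ (hS i), hexp _ hY, ← integral_sub (hi _ (hS i)) (hi _ hY), ← integral_const_mul]
    refine (norm_integral_le_integral_norm _).trans (integral_mono ((hi _ (hS i)).sub
      (hi _ hY)).norm ((hint i).abs.const_mul _) fun ω => ?_)
    have h2 : Complex.exp (t * S i ω * Complex.I) - Complex.exp (t * Y ω * Complex.I)
        = Complex.exp ((t * Y ω : ℝ) * Complex.I) *
          (Complex.exp (Complex.I * (t * (S i ω - Y ω) : ℝ)) - 1) := by
      rw [mul_sub, ← Complex.exp_add, mul_one]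
      congr 2 <;> push_cast <;> ring
    simp only
    rw [h2, norm_mul, Complex.norm_exp_ofReal_mul_I, one_mul]
    refine (Real.norm_exp_I_mul_ofReal_sub_one_le).trans ?_
    rw [Real.norm_eq_abs, abs_mul, abs_sub_comm]
  have h2 : Filter.Tendsto (fun i => charFun (P.map (S i)) t) l
      (nhds (Complex.exp (-(t ^ 2 * v : ℝ) / 2))) := by
    simp_rw [hcf]
    have : Continuous fun x : ℝ => Complex.exp (-(t ^ 2 * x : ℝ) / 2) := by fun_prop
    exact (this.tendsto v).comp hσ
  rw [tendsto_nhds_unique h1 h2]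
  congr 1
  push_cast
  ring

section Field

variable {ι Y H : Type*} [MeasurableSpace Y] (μ : Measure Y) [IsFiniteMeasure μ]
  [NormedAddCommGroup H] [InnerProductSpace ℝ H]

/-- The summand `(ω, y) ↦ ω i ⟨b i, u y⟩` of the expansion of a Gaussian field. -/
noncomputable def fieldTerm (b : ι → H) (u : Y → H) (i : ι) (p : (ι → ℝ) × Y) : ℝ :=
  p.1 i * inner ℝ (b i) (u p.2)

variable {μ} {b : ι → H} {u : Y → H} {C : ℝ}

lemma memLp_inner (hu : StronglyMeasurable u) (hC : ∀ y, ‖u y‖ ≤ C) (c : H) :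
    MemLp (fun y => inner ℝ c (u y)) 2 μ := by
  refine MemLp.of_bound (stronglyMeasurable_const.inner hu).aestronglyMeasurable (‖c‖ * C)
    (Filter.Eventually.of_forall fun y => ?_)
  exact (norm_inner_le_norm _ _).trans (by gcongr; exact hC y)

lemma memLp_fieldTerm (hu : StronglyMeasurable u) (hC : ∀ y, ‖u y‖ ≤ C) (i : ι) :
    MemLp (fieldTerm b u i) 2 ((gaussianProduct ι).prod μ) :=
  have h1 := (memLp_coord i).integrable_sq.mul_prod (memLp_inner (μ := μ) hu hC (b i)).integrable_sq
  (memLp_two_iff_integrable_sq ((memLp_coord i).1.comp_fst.mul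
    (memLp_inner hu hC (b i)).1.comp_snd)).2 (h1.congr
      (Filter.Eventually.of_forall fun _ => (mul_pow _ _ 2).symm))

lemma integral_abs_le_norm_mul {Z : Type*} [MeasurableSpace Z] {ν : Measure Z} [IsFiniteMeasure ν]
    (f : Lp ℝ 2 ν) : ∫ z, |f z| ∂ν ≤ ‖f‖ * (ν Set.univ ^ (1 / 2 : ℝ)).toReal := by
  have h := eLpNorm_le_eLpNorm_mul_rpow_measure_univ (μ := ν) (p := 1) (q := 2) one_le_two
    (Lp.aestronglyMeasurable f)
  have h2 : ∫ z, |f z| ∂ν = (eLpNorm f 1 ν).toReal := by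
    rw [eLpNorm_one_eq_lintegral_enorm]
    exact integral_norm_eq_lintegral_enorm (Lp.aestronglyMeasurable f)
  rw [h2, Lp.norm_def, ← ENNReal.toReal_mul]
  refine ENNReal.toReal_mono (ENNReal.mul_ne_top (Lp.eLpNorm_ne_top f) ?_) (h.trans_eq ?_)
  · exact ENNReal.rpow_ne_top_of_nonneg (by norm_num) (measure_ne_top ν _)
  · norm_num

lemma integral_fieldTerm_mul (i j : ι) :
    ∫ p, fieldTerm b u i p * fieldTerm b u j p ∂((gaussianProduct ι).prod μ)
      = (∫ ω, ω i * ω j ∂gaussianProduct ι) *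
        ∫ y, inner ℝ (b i) (u y) * inner ℝ (b j) (u y) ∂μ := by
  rw [← integral_prod_mul]
  congr 1 with p
  simp only [fieldTerm]
  ring

/-- A Gaussian field with covariance `⟨u y, u y'⟩`, as a jointly measurable function on `Ω × Y`.
It is the sum in `L²(Ω × Y)` of the orthogonal series `∑ i, ω i ⟨b i, u y⟩`, where `b` is a
Hilbert basis and the `ω i` are independent standard Gaussian variables. -/
theorem exists_gaussian_field [CompleteSpace H] (b : HilbertBasis ι ℝ H)
    (hu : StronglyMeasurable u) (hC : ∀ y, ‖u y‖ ≤ C) :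
    ∃ U : (ι → ℝ) × Y → ℝ, StronglyMeasurable U ∧
      Integrable U ((gaussianProduct ι).prod μ) ∧
      ∀ (g : Y → ℝ) (M : ℝ), Measurable g → 0 ≤ M → (∀ y, |g y| ≤ M) →
        (gaussianProduct ι).map (fun ω => ∫ y, U (ω, y) * g y ∂μ)
          = gaussianReal 0 (‖∫ y, g y • u y ∂μ‖ ^ 2).toNNReal := by
  set P := gaussianProduct ι
  have hG := fun i => memLp_fieldTerm (μ := μ) (b := b) hu hC i
  set G : ι → Lp ℝ 2 (P.prod μ) := fun i => (hG i).toLp with hGdef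
  have hinner : ∀ i j, inner ℝ (G i) (G j)
      = ∫ p, fieldTerm b u i p * fieldTerm b u j p ∂(P.prod μ) := by
    intro i j
    rw [L2.inner_def]
    refine integral_congr_ae ?_
    filter_upwards [(hG i).coeFn_toLp, (hG j).coeFn_toLp] with p hi hj
    rw [hi, hj]
    simp [mul_comm]
  have horth : ∀ i j, i ≠ j → inner ℝ (G i) (G j) = 0 := fun i j hij => by
    rw [hinner, integral_fieldTerm_mul, integral_coord_mul hij, zero_mul]
  have hnorm : ∀ i, ‖G i‖ ^ 2 = ∫ y, inner ℝ (b i) (u y) ^ 2 ∂μ := fun i => by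
    rw [← real_inner_self_eq_norm_sq, hinner, integral_fieldTerm_mul, integral_coord_sq, one_mul]
    simp_rw [pow_two]
  have hC0 : ∀ y, ‖u y‖ ^ 2 ≤ C ^ 2 := fun y => by gcongr; exact hC y
  have hsum : Summable fun i => ‖G i‖ ^ 2 := by
    refine summable_of_sum_le (c := ∫ _ : Y, C ^ 2 ∂μ) (fun i => sq_nonneg _) fun s => ?_
    simp_rw [hnorm]
    rw [← integral_finsetSum _ fun i _ => (memLp_inner hu hC (b i)).integrable_sq]
    refine integral_mono (integrable_finsetSum _ fun i _ =>
      (memLp_inner hu hC (b i)).integrable_sq) (integrable_const _) fun y => ?_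
    refine le_trans ?_ (hC0 y)
    simpa using b.orthonormal.sum_inner_products_le (u y) (s := s)
  obtain ⟨A, hA⟩ := summable_of_pairwise_orthogonal horth hsum
  have hAint : Integrable A (P.prod μ) := (Lp.memLp A).integrable one_le_two
  refine ⟨A, Lp.stronglyMeasurable A, hAint, fun g M hg hM0 hM => ?_⟩
  have hgu : Integrable (fun y => g y • u y) μ := by
    refine Integrable.of_bound (hg.aestronglyMeasurable.smul hu.aestronglyMeasurable) (M * C)
      (Filter.Eventually.of_forall fun y => ?_)
    rw [norm_smul]
    exact mul_le_mul (hM y) (hC y) (norm_nonneg _) ((abs_nonneg _).trans (hM y))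
  have hYmeas : Measurable fun ω => ∫ y, A (ω, y) * g y ∂μ :=
    (StronglyMeasurable.integral_prod_right' (f := fun p : (ι → ℝ) × Y => A p * g p.2)
      ((Lp.stronglyMeasurable A).mul (hg.comp measurable_snd).stronglyMeasurable)).measurable
  have hpart : ∀ (s : Finset ι) (ω : ι → ℝ),
      ∑ i ∈ s, ω i * inner ℝ (b i) (∫ y, g y • u y ∂μ)
        = ∫ y, (∑ i ∈ s, fieldTerm b u i (ω, y)) * g y ∂μ := by
    intro s ω
    simp_rw [Finset.sum_mul]
    rw [integral_finsetSum]
    · refine Finset.sum_congr rfl fun i _ => ?_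
      rw [← integral_inner hgu, ← integral_const_mul]
      congr 1 with y
      rw [fieldTerm, inner_smul_right]
      ring
    · intro i _
      have := ((memLp_inner (μ := μ) hu hC (b i)).integrable one_le_two).const_mul (ω i)
      exact this.mul_bdd hg.aestronglyMeasurable (Filter.Eventually.of_forall hM)
  have hsumLp : ∀ s : Finset ι, ∀ᵐ p ∂(P.prod μ),
      (∑ i ∈ s, G i : Lp ℝ 2 (P.prod μ)) p = ∑ i ∈ s, fieldTerm b u i p := by
    intro s
    filter_upwards [Lp.coeFn_finsetSum s G, (ae_ball_iff s.countable_toSet).2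
      fun i _ => (hG i).coeFn_toLp] with p h1 h2
    rw [h1, Finset.sum_apply]
    exact Finset.sum_congr rfl fun i hi => h2 i hi
  have hdiff : ∀ s : Finset ι, Integrable (fun p : (ι → ℝ) × Y =>
      (A p - ∑ i ∈ s, fieldTerm b u i p) * g p.2) (P.prod μ) := by
    intro s
    refine (hAint.sub (integrable_finsetSum _ fun i _ => (hG i).integrable one_le_two)).mul_bdd
      (hg.comp measurable_snd).aestronglyMeasurable (Filter.Eventually.of_forall fun p => hM p.2)
  have hYS : ∀ s : Finset ι, (fun ω => (∫ y, A (ω, y) * g y ∂μ) -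
      ∑ i ∈ s, ω i * inner ℝ (b i) (∫ y, g y • u y ∂μ)) =ᵐ[P]
      fun ω => ∫ y, (A (ω, y) - ∑ i ∈ s, fieldTerm b u i (ω, y)) * g y ∂μ := by
    intro s
    filter_upwards [hAint.prod_right_ae] with ω hω
    rw [hpart, ← integral_sub]
    · simp_rw [sub_mul]
    · exact hω.mul_bdd hg.aestronglyMeasurable (Filter.Eventually.of_forall hM)
    · refine Integrable.mul_bdd (c := M) (integrable_finsetSum _ fun i _ => ?_)
        hg.aestronglyMeasurable (Filter.Eventually.of_forall hM)
      exact ((memLp_inner (μ := μ) hu hC (b i)).integrable one_le_two).const_mul (ω i)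
  refine map_eq_gaussianReal_of_tendsto (l := Filter.atTop) (sq_nonneg _)
    (S := fun (s : Finset ι) ω =>
      ∑ i ∈ s, ω i * inner ℝ (b i) (∫ y, g y • u y ∂μ))
    (fun s => Measurable.aemeasurable (by fun_prop)) hYmeas.aemeasurable
    (fun s t => charFun_map_sum_coord s _ t) ?_ (fun s => ?_) ?_
  · have h := b.hasSum_inner_mul_inner (∫ y, g y • u y ∂μ) (∫ y, g y • u y ∂μ)
    rw [real_inner_self_eq_norm_sq] at h
    refine h.congr fun s => Finset.sum_congr rfl fun i _ => ?_
    simp only [pow_two, real_inner_comm]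
  · exact (hdiff s).integral_prod_left.congr (hYS s).symm
  · have hlim : Filter.Tendsto (fun s : Finset ι => M * (‖A - ∑ i ∈ s, G i‖ *
        ((P.prod μ) Set.univ ^ (1 / 2 : ℝ)).toReal)) Filter.atTop (nhds 0) := by
      have h := ((tendsto_iff_norm_sub_tendsto_zero.1 hA).mul_const
        ((P.prod μ) Set.univ ^ (1 / 2 : ℝ)).toReal).const_mul M
      simp_rw [norm_sub_rev _ A] at h
      simpa using h
    refine squeeze_zero (fun s => integral_nonneg fun ω => abs_nonneg _) (fun s => ?_) hlim
    calc ∫ ω, |(∫ y, A (ω, y) * g y ∂μ) -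
          ∑ i ∈ s, ω i * inner ℝ (b i) (∫ y, g y • u y ∂μ)| ∂P
        = ∫ ω, |∫ y, (A (ω, y) - ∑ i ∈ s, fieldTerm b u i (ω, y)) * g y ∂μ| ∂P := by
          refine integral_congr_ae ?_
          filter_upwards [hYS s] with ω hω
          rw [hω]
      _ ≤ ∫ ω, ∫ y, |(A (ω, y) - ∑ i ∈ s, fieldTerm b u i (ω, y)) * g y| ∂μ ∂P :=
          integral_mono (hdiff s).integral_prod_left.abs (hdiff s).abs.integral_prod_left
            fun ω => abs_integral_le_integral_abs
      _ = ∫ p, |(A p - ∑ i ∈ s, fieldTerm b u i p) * g p.2| ∂(P.prod μ) :=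
          integral_integral (hdiff s).abs
      _ ≤ ∫ p, M * |(A - ∑ i ∈ s, G i : Lp ℝ 2 (P.prod μ)) p| ∂(P.prod μ) := by
          refine integral_mono_ae (hdiff s).abs
            (((Lp.memLp _).integrable one_le_two).abs.const_mul M) ?_
          filter_upwards [Lp.coeFn_sub A (∑ i ∈ s, G i), hsumLp s] with p h1 h2
          rw [h1, Pi.sub_apply, h2, abs_mul, mul_comm]
          exact mul_le_mul_of_nonneg_right (hM p.2) (abs_nonneg _)
      _ ≤ M * (‖A - ∑ i ∈ s, G i‖ * ((P.prod μ) Set.univ ^ (1 / 2 : ℝ)).toReal) := by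
          rw [integral_const_mul]
          exact mul_le_mul_of_nonneg_left (integral_abs_le_norm_mul _) hM0

end Field

/-! ### Spectral density -/

/-- The spectral density of `logKernel` on `ℝ^d`, the sum of the Fourier transforms of its Gaussian
components; the term `n = 0` vanishes because `(0 : ℝ)⁻¹ = 0`. -/
noncomputable def covSpectrum {d : ℕ} (ξ : Rn d) : ℝ :=
  ∑' n : ℕ, (n : ℝ)⁻¹ / 2 * gaussianSpectrum (Rn d) n ξ

lemma summable_covSpectrum {d : ℕ} (hd : 1 ≤ d) (ξ : Rn d) :
    Summable fun n : ℕ => (n : ℝ)⁻¹ / 2 * gaussianSpectrum (Rn d) n ξ := by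
  have hd' : (0 : ℝ) < d := by exact_mod_cast hd
  have hpi := Real.pi_pos
  refine Summable.of_nonneg_of_le (fun n => mul_nonneg (by positivity)
    (gaussianSpectrum_nonneg (by positivity) ξ)) (fun n => ?_)
    ((summable_inv_mul_rpow (δ := (d : ℝ) / 2) (by positivity)).mul_left (Real.pi ^ ((d : ℝ) / 2)))
  have h1 : Real.exp (-Real.pi ^ 2 * ‖ξ‖ ^ 2 / n) ≤ 1 := by
    rw [Real.exp_le_one_iff, neg_mul, neg_div, neg_nonpos]
    positivity
  rw [gaussianSpectrum, finrank_euclideanSpace_fin, Real.div_rpow hpi.le (by positivity),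
    Real.rpow_neg (by positivity)]
  calc _ ≤ (n : ℝ)⁻¹ / 2 * (Real.pi ^ ((d : ℝ) / 2) / (n : ℝ) ^ ((d : ℝ) / 2) * 1) := by gcongr
    _ = _ := by ring

lemma covSpectrum_nonneg {d : ℕ} (ξ : Rn d) : 0 ≤ covSpectrum ξ :=
  tsum_nonneg fun n => mul_nonneg (by positivity) (gaussianSpectrum_nonneg (by positivity) ξ)

lemma ofReal_covSpectrum_mul {d : ℕ} (hd : 1 ≤ d) (ξ : Rn d) {r : ℝ} (hr : 0 ≤ r) :
    ENNReal.ofReal (covSpectrum ξ * r)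
      = ∑' n : ℕ, ENNReal.ofReal ((n : ℝ)⁻¹ / 2 * gaussianSpectrum (Rn d) n ξ * r) := by
  rw [covSpectrum, ← tsum_mul_right, ENNReal.ofReal_tsum_of_nonneg]
  · exact fun n => mul_nonneg (mul_nonneg (by positivity)
      (gaussianSpectrum_nonneg (by positivity) ξ)) hr
  · exact (summable_covSpectrum hd ξ).mul_right r

lemma measurable_covSpectrum {d : ℕ} (hd : 1 ≤ d) : Measurable (covSpectrum (d := d)) := by
  have h : covSpectrum (d := d) = fun ξ =>
      (∑' n : ℕ, ENNReal.ofReal ((n : ℝ)⁻¹ / 2 * gaussianSpectrum (Rn d) n ξ * 1)).toReal := by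
    ext ξ
    rw [← ofReal_covSpectrum_mul hd ξ zero_le_one, mul_one,
      ENNReal.toReal_ofReal (covSpectrum_nonneg ξ)]
  rw [h]
  refine (Measurable.tsum fun n => ?_).ennreal_toReal
  exact ((continuous_const.mul (continuous_gaussianSpectrum _)).mul
    continuous_const).measurable.ennreal_ofReal

/-- The integral of a Gaussian spectrum against a weight in a single coordinate: the other
coordinates contribute a factor `1`. -/
lemma lintegral_gaussianSpectrum_div_le {d : ℕ} (i : Fin d) {t : ℝ} (ht : 0 < t) :
    ∫⁻ ξ : Rn d, ENNReal.ofReal (gaussianSpectrum (Rn d) t ξ * (1 + (2 * Real.pi * ξ i) ^ 2)⁻¹)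
      ≤ ENNReal.ofReal (Real.pi * Real.sqrt (Real.pi / t)) := by
  classical
  have hpi := Real.pi_pos
  have hb : 0 < Real.pi ^ 2 / t := by positivity
  set g : ℝ → ℝ := fun x => Real.sqrt (Real.pi / t) * Real.exp (-(Real.pi ^ 2 / t) * x ^ 2) with hg
  have hgint : Integrable g := (integrable_exp_neg_mul_sq hb).const_mul _
  have hg1 : ∫ x, g x = 1 := by
    rw [hg, integral_const_mul, integral_gaussian, ← Real.sqrt_mul (by positivity)]
    rw [show Real.pi / t * (Real.pi / (Real.pi ^ 2 / t)) = 1 by field_simp, Real.sqrt_one]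
  set F : Fin d → ℝ → ℝ := fun j x => if j = i then Real.sqrt (Real.pi / t) * (1 + x ^ 2)⁻¹ else g x
    with hF
  have hFint : ∀ j, Integrable (F j) := by
    intro j
    by_cases hj : j = i
    · simp only [hF, hj, if_true]; exact integrable_inv_one_add_sq.const_mul _
    · simp only [hF, hj, if_false]; exact hgint
  have hFnn : ∀ j x, 0 ≤ F j x := by
    intro j x
    simp only [hF]
    split_ifs <;> positivity
  have hprodint : Integrable fun x : Fin d → ℝ => ∏ j, F j (x j) :=
    Integrable.fintype_prod hFint
  have hprod : ∫ x : Fin d → ℝ, ∏ j, F j (x j) = Real.pi * Real.sqrt (Real.pi / t) := by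
    rw [integral_fintype_prod_volume_eq_prod, Finset.prod_eq_single i]
    · simp only [hF, if_true]
      rw [integral_const_mul, integral_univ_inv_one_add_sq, mul_comm]
    · intro j _ hj
      simp only [hF, hj, if_false]
      exact hg1
    · simp
  have hle : ∀ ξ : Rn d, gaussianSpectrum (Rn d) t ξ * (1 + (2 * Real.pi * ξ i) ^ 2)⁻¹
      ≤ ∏ j, F j (ξ j) := by
    intro ξ
    have h1 : gaussianSpectrum (Rn d) t ξ = ∏ j, g (ξ j) := by
      rw [gaussianSpectrum, finrank_euclideanSpace_fin, EuclideanSpace.real_norm_sq_eq]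
      simp only [hg, Finset.prod_mul_distrib, Finset.prod_const, Finset.card_univ,
        Fintype.card_fin, ← Real.exp_sum]
      congr 1
      · rw [Real.sqrt_eq_rpow, ← Real.rpow_natCast, ← Real.rpow_mul (by positivity)]
        congr 1; ring
      · rw [← Finset.mul_sum]; congr 1; ring
    rw [h1, ← Finset.mul_prod_erase _ _ (Finset.mem_univ i),
      ← Finset.mul_prod_erase _ (fun j => F j (ξ j)) (Finset.mem_univ i), mul_right_comm]
    have h2 : ∏ j ∈ Finset.univ.erase i, F j (ξ j) = ∏ j ∈ Finset.univ.erase i, g (ξ j) :=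
      Finset.prod_congr rfl fun j hj => by simp [hF, Finset.ne_of_mem_erase hj]
    rw [h2]
    refine mul_le_mul_of_nonneg_right ?_ (Finset.prod_nonneg fun j _ => by positivity)
    simp only [hF, if_true, hg]
    refine mul_le_mul ?_ ?_ (by positivity) (by positivity)
    · refine mul_le_of_le_one_right (by positivity) ?_
      rw [Real.exp_le_one_iff, neg_mul, neg_nonpos]
      positivity
    · refine inv_anti₀ (by positivity) ?_
      have : 1 ≤ (2 * Real.pi) ^ 2 := by nlinarith [Real.pi_gt_three]
      rw [mul_pow]
      nlinarith [sq_nonneg (ξ i)]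
  calc _ ≤ ∫⁻ ξ : Rn d, ENNReal.ofReal (∏ j, F j (ξ j)) :=
        lintegral_mono fun ξ => ENNReal.ofReal_le_ofReal (hle ξ)
    _ = ∫⁻ x : Fin d → ℝ, ENNReal.ofReal (∏ j, F j (x j)) :=
        (PiLp.volume_preserving_ofLp (Fin d)).lintegral_comp_emb
          (MeasurableEquiv.toLp 2 (Fin d → ℝ)).symm.measurableEmbedding fun x =>
            ENNReal.ofReal (∏ j, F j (x j))
    _ = _ := by
        rw [← hprod, ofReal_integral_eq_lintegral_ofReal hprodint]
        exact Filter.Eventually.of_forall fun x => Finset.prod_nonneg fun j _ => hFnn j _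

/-- One derivative in a single direction is enough to make the spectral density integrable. -/
lemma integrable_covSpectrum_mul {d : ℕ} (hd : 1 ≤ d) (i : Fin d) :
    Integrable fun ξ : Rn d => covSpectrum ξ * (1 + (2 * Real.pi * ξ i) ^ 2)⁻¹ := by
  have hpi := Real.pi_pos
  have hmeasw : Measurable fun ξ : Rn d => (1 + (2 * Real.pi * ξ i) ^ 2)⁻¹ := by fun_prop
  refine ⟨((measurable_covSpectrum hd).mul hmeasw).aestronglyMeasurable, ?_⟩
  have hw : ∀ ξ : Rn d, 0 ≤ (1 + (2 * Real.pi * ξ i) ^ 2)⁻¹ := fun ξ => by positivity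
  have h1 : ∀ ξ : Rn d, ‖covSpectrum ξ * (1 + (2 * Real.pi * ξ i) ^ 2)⁻¹‖ₑ
      = ∑' n : ℕ, ENNReal.ofReal ((n : ℝ)⁻¹ / 2 * gaussianSpectrum (Rn d) n ξ *
        (1 + (2 * Real.pi * ξ i) ^ 2)⁻¹) := fun ξ => by
    rw [← ofReal_covSpectrum_mul hd ξ (hw ξ),
      Real.enorm_of_nonneg (mul_nonneg (covSpectrum_nonneg ξ) (hw ξ))]
  have h2 : ∀ n : ℕ, ∫⁻ ξ : Rn d, ENNReal.ofReal ((n : ℝ)⁻¹ / 2 * gaussianSpectrum (Rn d) n ξ *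
        (1 + (2 * Real.pi * ξ i) ^ 2)⁻¹)
      ≤ ENNReal.ofReal (Real.pi * Real.sqrt Real.pi *
          ((n : ℝ)⁻¹ / 2 * (n : ℝ) ^ (-(1 / 2) : ℝ))) := by
    intro n
    rcases Nat.eq_zero_or_pos n with rfl | hn
    · simp
    have hn' : (0 : ℝ) < n := by exact_mod_cast hn
    have hb : 0 ≤ (n : ℝ)⁻¹ / 2 := by positivity
    simp_rw [mul_assoc ((n : ℝ)⁻¹ / 2), ENNReal.ofReal_mul hb]
    rw [lintegral_const_mul' _ _ ENNReal.ofReal_ne_top]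
    refine (mul_le_mul_right (lintegral_gaussianSpectrum_div_le i hn') _).trans ?_
    rw [← ENNReal.ofReal_mul hb]
    refine ENNReal.ofReal_le_ofReal (le_of_eq ?_)
    rw [Real.sqrt_div hpi.le, Real.rpow_neg hn'.le, ← Real.sqrt_eq_rpow]
    ring
  rw [HasFiniteIntegral]
  simp_rw [h1]
  rw [lintegral_tsum]
  · refine (ENNReal.tsum_le_tsum h2).trans_lt ?_
    rw [← ENNReal.ofReal_tsum_of_nonneg (fun n => by positivity)
      ((summable_inv_mul_rpow (by norm_num)).mul_left _)]
    exact ENNReal.ofReal_lt_top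
  · intro n
    exact (((continuous_const.mul (continuous_gaussianSpectrum _)).measurable.mul
      hmeasw).ennreal_ofReal).aemeasurable

/-! ### Stationary kernels as Gram matrices -/

section Spectral

variable {V : Type*} [NormedAddCommGroup V] [InnerProductSpace ℝ V] [FiniteDimensional ℝ V]
  [MeasurableSpace V] [BorelSpace V]

/-- Bochner's theorem in the easy direction: the Fourier transform of a nonnegative integrable
function is the Gram kernel of a continuous curve of vectors in `L²`. -/
lemma exists_inner_eq_fourier {W : V → ℝ} (hW : Integrable W) (hW0 : ∀ ξ, 0 ≤ W ξ) :
    ∃ u : V → Lp ℂ 2 (volume : Measure V), Continuous u ∧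
      ∀ x y, inner ℝ (u x) (u y) = (𝓕 (fun ξ => (W ξ : ℂ)) (x - y)).re := by
  set w : V → V → ℂ := fun x ξ => Real.fourierChar (inner ℝ ξ x) • (Real.sqrt (W ξ) : ℂ) with hw
  have hmem : ∀ x, MemLp (w x) 2 (volume : Measure V) := by
    intro x
    have hmeas : AEStronglyMeasurable (fun ξ => (Real.sqrt (W ξ) : ℂ)) volume :=
      Complex.continuous_ofReal.comp_aestronglyMeasurable
        (Real.continuous_sqrt.comp_aestronglyMeasurable hW.1)
    refine (memLp_two_iff_integrable_sq_norm ?_).2 (hW.congr ?_)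
    · refine AEStronglyMeasurable.smul ?_ hmeas
      have h : Continuous fun ξ : V => ((Real.fourierChar (inner ℝ ξ x) : Circle) : ℂ) :=
        Continuous.comp continuous_subtype_val
          (Real.continuous_fourierChar.comp (continuous_id.inner continuous_const))
      exact h.aestronglyMeasurable
    · refine Filter.Eventually.of_forall fun ξ => ?_
      simp only [hw]
      rw [Circle.norm_smul, Complex.norm_real, Real.norm_eq_abs, sq_abs, Real.sq_sqrt (hW0 ξ)]
  have hinner : ∀ x y, inner ℝ ((hmem x).toLp) ((hmem y).toLp)
      = (𝓕 (fun ξ => (W ξ : ℂ)) (x - y)).re := by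
    intro x y
    rw [L2.inner_def, Real.fourier_eq, ← RCLike.re_eq_complex_re, ← integral_re]
    · refine integral_congr_ae ?_
      filter_upwards [(hmem x).coeFn_toLp, (hmem y).coeFn_toLp] with ξ hx hy
      rw [hx, hy]
      simp only [hw, Complex.inner, Circle.smul_def, smul_eq_mul, map_mul, Complex.conj_ofReal,
        RCLike.re_eq_complex_re]
      congr 1
      rw [inner_sub_right, neg_sub, sub_eq_add_neg, AddChar.map_add_eq_mul, AddChar.map_neg_eq_inv,
        Circle.coe_mul, Circle.coe_inv_eq_conj]
      have h2 : (W ξ : ℂ) = (Real.sqrt (W ξ) : ℂ) * (Real.sqrt (W ξ) : ℂ) := by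
        rw [← Complex.ofReal_mul, Real.mul_self_sqrt (hW0 ξ)]
      rw [h2]
      ring
    · exact (Real.fourierIntegral_convergent_iff (x - y)).2 hW.ofReal
  refine ⟨fun x => (hmem x).toLp, ?_, hinner⟩
  have hcont : Continuous (𝓕 (fun ξ => (W ξ : ℂ))) := continuous_fourier hW.ofReal
  rw [continuous_iff_continuousAt]
  intro x
  have hlim : Filter.Tendsto (fun y => Real.sqrt (2 * (𝓕 (fun ξ => (W ξ : ℂ)) 0).re -
      2 * (𝓕 (fun ξ => (W ξ : ℂ)) (y - x)).re)) (nhds x) (nhds 0) := by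
    have h : Continuous fun y => Real.sqrt (2 * (𝓕 (fun ξ => (W ξ : ℂ)) 0).re -
      2 * (𝓕 (fun ξ => (W ξ : ℂ)) (y - x)).re) := by fun_prop
    simpa using h.tendsto x
  rw [ContinuousAt, tendsto_iff_norm_sub_tendsto_zero]
  refine hlim.congr fun y => ?_
  rw [← Real.sqrt_sq (norm_nonneg _)]
  congr 1
  rw [norm_sub_sq_real, ← real_inner_self_eq_norm_sq, ← real_inner_self_eq_norm_sq, hinner,
    hinner, hinner, sub_self, sub_self]
  ring

/-- The squared norm of a weighted average of the vectors of a Gram kernel, in Fourier space. -/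
lemma norm_integral_smul_sq {H : Type*} [NormedAddCommGroup H] [InnerProductSpace ℝ H]
    [CompleteSpace H] {W : V → ℝ} (hW : Integrable W) {u : V → H}
    (hinner : ∀ x y, inner ℝ (u x) (u y) = (𝓕 (fun ξ => (W ξ : ℂ)) (x - y)).re)
    {f : V → ℝ} (hf : Integrable f) (hfu : Integrable fun x => f x • u x) :
    ‖∫ x, f x • u x‖ ^ 2 = ∫ ξ, W ξ * ‖𝓕 (fun x => (f x : ℂ)) ξ‖ ^ 2 := by
  have hcont : Continuous (𝓕 (fun ξ => (W ξ : ℂ))) := continuous_fourier hW.ofReal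
  have hint : Integrable (fun p : V × V => (f p.1 : ℂ) * f p.2 * 𝓕 (fun ξ => (W ξ : ℂ)) (p.1 - p.2))
      (volume.prod volume) := by
    refine (hf.ofReal.mul_prod hf.ofReal).mul_bdd (c := ∫ x, ‖(W x : ℂ)‖)
      (Continuous.aestronglyMeasurable (by fun_prop))
      (Filter.Eventually.of_forall fun p => norm_fourier_le _ _)
  have h1 : ‖∫ x, f x • u x‖ ^ 2
      = ∫ x, ∫ y, ((f x : ℂ) * f y * 𝓕 (fun ξ => (W ξ : ℂ)) (x - y)).re := by
    rw [← real_inner_self_eq_norm_sq, ← integral_inner hfu]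
    congr 1 with x
    rw [inner_smul_right, real_inner_comm, ← integral_inner hfu, ← integral_const_mul]
    congr 1 with y
    rw [inner_smul_right, hinner, ← Complex.ofReal_mul, Complex.re_ofReal_mul]
    ring
  rw [h1, integral_integral (f := fun x y => ((f x : ℂ) * f y * 𝓕 (fun ξ => (W ξ : ℂ)) (x - y)).re)
    hint.re]
  have h2 := integral_re hint
  simp only [RCLike.re_eq_complex_re] at h2
  rw [h2, integral_prod _ hint, integral_integral_fourier_sub hf hW, Complex.ofReal_re]

end Spectral

/-! ### Random linear functionals with Gaussian one-dimensional laws -/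

section Linear

variable {E Ω : Type*} [AddCommGroup E] [Module ℝ E] [MeasurableSpace Ω] {P : Measure Ω}
  {X : Ω → E →ₗ[ℝ] ℝ} {Q : LinearMap.BilinForm ℝ E}

/-- A random linear functional is a Gaussian process as soon as its one-dimensional laws are
Gaussian: linear combinations of its values are again values of it. -/
lemma isGaussianProcess_of_map_eq (hX : ∀ x, Measurable fun ω => X ω x)
    (hlaw : ∀ x, P.map (fun ω => X ω x) = gaussianReal 0 (Q x x).toNNReal) :
    IsGaussianProcess (fun x ω => X ω x) P := by
  classical
  refine ⟨fun I => ⟨isGaussian_of_map_eq_gaussianReal fun L => ?_⟩⟩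
  have hL : ∀ ω, L (I.restrict fun x => X ω x)
      = X ω (∑ x : I, L (Pi.single x 1) • (x : E)) := by
    intro ω
    rw [map_sum, ← Finset.univ_sum_single (I.restrict fun x => X ω x), map_sum]
    refine Finset.sum_congr rfl fun x _ => ?_
    rw [map_smul, smul_eq_mul, Finset.restrict, mul_comm, ← smul_eq_mul, ← map_smul,
      ← Pi.single_smul, smul_eq_mul, mul_one]
  refine ⟨0, (Q (∑ x : I, L (Pi.single x 1) • (x : E))
    (∑ x : I, L (Pi.single x 1) • (x : E))).toNNReal, ?_⟩
  have hm : Measurable fun ω => I.restrict fun x => X ω x := measurable_pi_lambda _ fun x => hX x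
  rw [Measure.map_map L.continuous.measurable hm, ← hlaw]
  congr 1
  ext ω
  exact hL ω

lemma integral_eq_zero_of_map_eq (hX : ∀ x, Measurable fun ω => X ω x)
    (hlaw : ∀ x, P.map (fun ω => X ω x) = gaussianReal 0 (Q x x).toNNReal) (x : E) :
    ∫ ω, X ω x ∂P = 0 := by
  have h : ∫ r, r ∂(P.map (fun ω => X ω x)) = 0 := by
    rw [hlaw]; exact integral_id_gaussianReal
  rwa [integral_map (hX x).aemeasurable (by fun_prop)] at h

/-- The covariance is recovered from the variances by polarization. -/
lemma integral_mul_of_map_eq (hX : ∀ x, Measurable fun ω => X ω x)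
    (hlaw : ∀ x, P.map (fun ω => X ω x) = gaussianReal 0 (Q x x).toNNReal)
    (hQ0 : ∀ x, 0 ≤ Q x x) (hQ : ∀ x y, Q x y = Q y x) (x y : E) :
    ∫ ω, X ω x * X ω y ∂P = Q x y := by
  have hmem : ∀ x, MemLp (fun ω => X ω x) 2 P := fun x => by
    have h : MemLp id 2 (P.map (fun ω => X ω x)) := by
      rw [hlaw]; exact memLp_id_gaussianReal 2
    exact (memLp_map_measure_iff h.1 (hX x).aemeasurable).1 h
  have hsq : ∀ x, ∫ ω, X ω x ^ 2 ∂P = Q x x := fun x => by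
    have h1 : ∫ r, r ^ 2 ∂(P.map (fun ω => X ω x)) = Q x x := by
      have h := variance_id_gaussianReal (μ := 0) (v := (Q x x).toNNReal)
      rw [variance_eq_sub (memLp_id_gaussianReal 2), Real.coe_toNNReal _ (hQ0 x)] at h
      rw [hlaw]
      simpa using h
    rwa [integral_map (hX x).aemeasurable (by fun_prop)] at h1
  have h1 : ∀ ω, X ω x * X ω y = (X ω (x + y) ^ 2 - X ω x ^ 2 - X ω y ^ 2) / 2 := fun ω => by
    rw [map_add]; ring
  simp_rw [h1]
  have h2 := integral_sub ((hmem (x + y)).integrable_sq.sub (hmem x).integrable_sq)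
    (hmem y).integrable_sq
  have h3 := integral_sub (hmem (x + y)).integrable_sq (hmem x).integrable_sq
  simp only [Pi.sub_apply] at h2
  rw [integral_div, h2, h3, hsq, hsq, hsq]
  simp only [map_add, LinearMap.add_apply]
  rw [hQ y x]
  ring

end Linear

/-! ### Construction of the field -/

lemma integrable_mul_mul_kernel {V : Type*} [NormedAddCommGroup V] [InnerProductSpace ℝ V]
    [FiniteDimensional ℝ V] [MeasurableSpace V] [BorelSpace V] {K f g : V → ℝ}
    (hK : Integrable K) (hf : Continuous f) {M : ℝ} (hM : ∀ x, |f x| ≤ M) (hg : Integrable g) :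
    Integrable (fun p : V × V => f p.1 * g p.2 * K (p.1 - p.2)) (volume.prod volume) := by
  have h := (hg.convolution_integrand (ContinuousLinearMap.mul ℝ ℝ) hK).bdd_mul (c := M)
    (f := fun p : V × V => f p.1) (by fun_prop) (Filter.Eventually.of_forall fun p => hM p.1)
  refine h.congr (Filter.Eventually.of_forall fun p => ?_)
  simp [mul_assoc]

/-- The bilinear form on test functions given by a stationary kernel. -/
noncomputable def kernelForm {d : ℕ} (D : Opens (Rn d)) {K : Rn d → ℝ} (hK : Integrable K) :
    LinearMap.BilinForm ℝ 𝓓(D, ℝ) :=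
  have hint : ∀ ψ₁ ψ₂ : 𝓓(D, ℝ), Integrable (fun p : Rn d × Rn d =>
      ψ₁ p.1 * ψ₂ p.2 * K (p.1 - p.2)) (volume.prod volume) := fun ψ₁ ψ₂ =>
    integrable_mul_mul_kernel hK ψ₁.continuous (exists_abs_testFunction_le ψ₁).choose_spec
      (integrable_testFunction ψ₂)
  LinearMap.mk₂ ℝ (fun ψ₁ ψ₂ => ∫ p : Rn d × Rn d, ψ₁ p.1 * ψ₂ p.2 * K (p.1 - p.2))
    (fun ψ₁ ψ₁' ψ₂ => by
      refine Eq.trans ?_ (integral_add (hint _ _) (hint _ _))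
      congr 1 with p
      rw [_root_.add_apply]
      ring)
    (fun c ψ₁ ψ₂ => by
      rw [smul_eq_mul, ← integral_const_mul]
      congr 1 with p
      rw [_root_.smul_apply, smul_eq_mul]
      ring)
    (fun ψ₁ ψ₂ ψ₂' => by
      refine Eq.trans ?_ (integral_add (hint _ _) (hint _ _))
      congr 1 with p
      rw [_root_.add_apply]
      ring)
    (fun c ψ₁ ψ₂ => by
      rw [smul_eq_mul, ← integral_const_mul]
      congr 1 with p
      rw [_root_.smul_apply, smul_eq_mul]
      ring)

lemma kernelForm_apply {d : ℕ} {D : Opens (Rn d)} {K : Rn d → ℝ} (hK : Integrable K)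
    (ψ₁ ψ₂ : 𝓓(D, ℝ)) :
    kernelForm D hK ψ₁ ψ₂ = ∫ x, ∫ y, ψ₁ x * ψ₂ y * K (x - y) :=
  integral_prod _ (integrable_mul_mul_kernel hK ψ₁.continuous
    (exists_abs_testFunction_le ψ₁).choose_spec (integrable_testFunction ψ₂))

lemma kernelForm_comm {d : ℕ} {D : Opens (Rn d)} {K : Rn d → ℝ} (hK : Integrable K)
    (heven : ∀ x, K (-x) = K x) (ψ₁ ψ₂ : 𝓓(D, ℝ)) :
    kernelForm D hK ψ₁ ψ₂ = kernelForm D hK ψ₂ ψ₁ := by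
  refine (integral_prod_swap (μ := (volume : Measure (Rn d))) (ν := (volume : Measure (Rn d)))
    fun p : Rn d × Rn d => ψ₁ p.1 * ψ₂ p.2 * K (p.1 - p.2)).symm.trans ?_
  refine integral_congr_ae (Filter.Eventually.of_forall fun p => ?_)
  simp only [Prod.fst_swap, Prod.snd_swap]
  rw [← heven, neg_sub]
  ring

/-- A distribution given by an integrable function on `D`, composed with a continuous linear
operator on test functions. If the function is not integrable, the distribution is `0`. -/
noncomputable def integralDistribution {d : ℕ} {D : Opens (Rn d)} (L : 𝓓(D, ℝ) →L[ℝ] 𝓓(D, ℝ))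
    (φ : Rn d → ℝ) : 𝓓'(D, ℝ) := open scoped Classical in
  if Integrable φ (volume.restrict D) then
    ContinuousLinearMap.toUniformConvergenceCLM _ _ _
      ((TestFunction.integralAgainstBilinCLM (ContinuousLinearMap.mul ℝ ℝ) (volume.restrict D) φ :
        𝓓(D, ℝ) →L[ℝ] ℝ).comp L)
  else 0

open scoped Classical in
lemma integralDistribution_apply {d : ℕ} {D : Opens (Rn d)} (L : 𝓓(D, ℝ) →L[ℝ] 𝓓(D, ℝ))
    (φ : Rn d → ℝ) (ψ : 𝓓(D, ℝ)) :
    integralDistribution L φ ψ = if Integrable φ (volume.restrict D) then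
      ∫ x in (D : Set (Rn d)), φ x * L ψ x else 0 := by
  rw [integralDistribution]
  split_ifs with h
  · have hloc : LocallyIntegrableOn φ D (volume.restrict (D : Set (Rn d))) :=
      h.locallyIntegrable.locallyIntegrableOn _
    refine (TestFunction.integralAgainstBilinCLM_eq_integral hloc).trans ?_
    congr 1 with x
    exact mul_comm _ _
  · rfl

/-- The random distribution with density a Gaussian field, transposed by `L`. -/
lemma exists_random_distribution {d : ℕ} {D : Opens (Rn d)}
    (hD : Bornology.IsBounded (D : Set (Rn d))) (L : 𝓓(D, ℝ) →L[ℝ] 𝓓(D, ℝ))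
    {W : Rn d → ℝ} (hW : Integrable W) (hW0 : ∀ ξ, 0 ≤ W ξ) :
    ∃ (Ω : Type) (_ : MeasurableSpace Ω) (P : Measure Ω) (_ : IsProbabilityMeasure P)
      (X : Ω → 𝓓'(D, ℝ)), ∀ ψ : 𝓓(D, ℝ), (Measurable fun ω => X ω ψ) ∧
        P.map (fun ω => X ω ψ) = gaussianReal 0
          (∫ ξ, W ξ * ‖𝓕 (fun x => (L ψ x : ℂ)) ξ‖ ^ 2).toNNReal := by
  classical
  obtain ⟨u, hu, hinner⟩ := exists_inner_eq_fourier hW hW0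
  obtain ⟨w, b, -⟩ := exists_hilbertBasis ℝ (Lp ℂ 2 (volume : Measure (Rn d)))
  have hC : ∀ y, ‖u y‖ ≤ ‖u 0‖ := fun y => by
    refine le_of_eq ((sq_eq_sq₀ (norm_nonneg _) (norm_nonneg _)).1 ?_)
    rw [← real_inner_self_eq_norm_sq, ← real_inner_self_eq_norm_sq, hinner, hinner, sub_self,
      sub_self]
  have : IsFiniteMeasure (volume.restrict (D : Set (Rn d))) :=
    isFiniteMeasure_restrict.2 hD.measure_lt_top.ne
  obtain ⟨U, hU, hUint, hlaw⟩ := exists_gaussian_field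
    (μ := volume.restrict (D : Set (Rn d))) b hu.stronglyMeasurable hC
  refine ⟨w → ℝ, inferInstance, gaussianProduct w, inferInstance,
    fun ω => integralDistribution L fun y => U (ω, y), fun ψ => ?_⟩
  have hm : StronglyMeasurable fun ω => ∫ x in (D : Set (Rn d)), U (ω, x) * L ψ x :=
    StronglyMeasurable.integral_prod_right' (f := fun p : (w → ℝ) × Rn d => U p * L ψ p.2)
      (hU.mul ((L ψ).continuous.measurable.comp measurable_snd).stronglyMeasurable)
  have hset : MeasurableSet
      {ω | Integrable (fun y => U (ω, y)) (volume.restrict (D : Set (Rn d)))} :=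
    _root_.measurableSet_integrable (f := fun ω y => U (ω, y)) hU
  simp_rw [integralDistribution_apply]
  refine ⟨Measurable.ite hset hm.measurable measurable_const, ?_⟩
  obtain ⟨M, hM⟩ := exists_abs_testFunction_le (L ψ)
  have h1 := hlaw (L ψ) M (L ψ).continuous.measurable ((abs_nonneg _).trans (hM 0)) hM
  have hfu : Integrable fun x => L ψ x • u x :=
    (integrable_testFunction (L ψ)).smul_bdd ‖u 0‖ hu.aestronglyMeasurable
      (Filter.Eventually.of_forall hC)
  rw [setIntegral_eq_integral_of_forall_compl_eq_zero
    (fun x hx => by simp [apply_eq_zero_of_notMem (L ψ) hx]),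
    norm_integral_smul_sq hW hinner (integrable_testFunction _) hfu] at h1
  rw [← h1]
  refine Measure.map_congr ?_
  filter_upwards [hUint.prod_right_ae] with ω hω
  rw [if_pos hω]

/-! ### Existence of the log-correlated field -/

lemma hasSum_logKernel {d : ℕ} {x : Rn d} (hx : x ≠ 0) :
    HasSum (fun n : ℕ => (n : ℝ)⁻¹ / 2 * Real.exp (-(n : ℝ) * ‖x‖ ^ 2)) (logKernel x) :=
  hasSum_exp_div (by positivity)

lemma integrable_logKernel {d : ℕ} (hd : 1 ≤ d) : Integrable (logKernel (d := d)) := by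
  have : Nonempty (Fin d) := ⟨⟨0, hd⟩⟩
  have hd' : (0 : ℝ) < d := by exact_mod_cast hd
  have hpi := Real.pi_pos
  refine ⟨Measurable.aestronglyMeasurable (by unfold logKernel; fun_prop), ?_⟩
  have h1 : ∀ᵐ x : Rn d, ‖logKernel x‖ₑ
      = ∑' n : ℕ, ENNReal.ofReal ((n : ℝ)⁻¹ / 2 * Real.exp (-(n : ℝ) * ‖x‖ ^ 2)) := by
    filter_upwards [(measure_eq_zero_iff_ae_notMem (μ := (volume : Measure (Rn d)))
      (s := {0})).1 (measure_singleton 0)] with x hx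
    have h := hasSum_logKernel hx
    rw [← ENNReal.ofReal_tsum_of_nonneg (fun n => by positivity) h.summable, h.tsum_eq,
      Real.enorm_of_nonneg (h.nonneg fun n => by positivity)]
  have h2 : ∀ n : ℕ, ∫⁻ x : Rn d, ENNReal.ofReal ((n : ℝ)⁻¹ / 2 * Real.exp (-(n : ℝ) * ‖x‖ ^ 2))
      ≤ ENNReal.ofReal (Real.pi ^ ((d : ℝ) / 2) *
          ((n : ℝ)⁻¹ / 2 * (n : ℝ) ^ (-((d : ℝ) / 2)))) := by
    intro n
    rcases Nat.eq_zero_or_pos n with rfl | hn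
    · simp
    have hn' : (0 : ℝ) < n := by exact_mod_cast hn
    rw [← ofReal_integral_eq_lintegral_ofReal ((integrable_exp_neg_mul_sq_norm hn').const_mul _)
      (Filter.Eventually.of_forall fun x => by positivity), integral_const_mul,
      GaussianFourier.integral_rexp_neg_mul_sq_norm hn', finrank_euclideanSpace_fin,
      Real.div_rpow hpi.le hn'.le, Real.rpow_neg hn'.le]
    exact ENNReal.ofReal_le_ofReal (le_of_eq (by ring))
  rw [HasFiniteIntegral, lintegral_congr_ae h1, lintegral_tsum fun n => by fun_prop]
  refine (ENNReal.tsum_le_tsum h2).trans_lt ?_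
  rw [← ENNReal.ofReal_tsum_of_nonneg (fun n => by positivity)
    ((summable_inv_mul_rpow (by positivity)).mul_left _)]
  exact ENNReal.ofReal_lt_top

/-- Plancherel's formula for the quadratic form of the logarithmic kernel. -/
lemma integral_covSpectrum_mul {d : ℕ} (hd : 1 ≤ d) [Nontrivial (Rn d)] {f : Rn d → ℝ}
    (hf : Integrable f) {M : ℝ} (hM : ∀ x, |f x| ≤ M) :
    0 ≤ ∫ x, ∫ y, f x * f y * logKernel (x - y) ∧
    ∫ ξ, covSpectrum ξ * ‖𝓕 (fun x => (f x : ℂ)) ξ‖ ^ 2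
      = ∫ x, ∫ y, f x * f y * logKernel (x - y) := by
  have hd' : (0 : ℝ) < d := by exact_mod_cast hd
  have hb : ∀ n : ℕ, 0 ≤ (n : ℝ)⁻¹ / 2 := fun n => by positivity
  have hQ := hasSum_integral_integral_gaussian (V := Rn d) hb
    (by rw [finrank_euclideanSpace_fin]; exact summable_inv_mul_rpow (by positivity))
    (fun x hx => hasSum_logKernel hx) hf hM
  obtain ⟨h0, -, h1⟩ := nonneg_and_lintegral_tsum_gaussianSpectrum hb hf hQ
  refine ⟨h0, ?_⟩
  rw [integral_eq_lintegral_of_nonneg_ae]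
  · simp_rw [ofReal_covSpectrum_mul hd _ (sq_nonneg _)]
    rw [h1 (by simp), ENNReal.toReal_ofReal h0]
  · exact Filter.Eventually.of_forall fun ξ => mul_nonneg (covSpectrum_nonneg ξ) (sq_nonneg _)
  · exact (measurable_covSpectrum hd).aestronglyMeasurable.mul
      ((continuous_fourier hf.ofReal).norm.pow 2).aestronglyMeasurable

lemma norm_fourier_add_lineDeriv_sq {d : ℕ} {D : Opens (Rn d)} (ψ : 𝓓(D, ℝ)) (v ξ : Rn d) :
    ‖𝓕 (fun x => ((ψ x + lineDeriv ℝ ψ x v : ℝ) : ℂ)) ξ‖ ^ 2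
      = (1 + (2 * Real.pi * inner ℝ ξ v) ^ 2) * ‖𝓕 (fun x => (ψ x : ℂ)) ξ‖ ^ 2 := by
  have h1 : (fun x => ((ψ x + lineDeriv ℝ ψ x v : ℝ) : ℂ))
      = ⇑(toSchwartz ψ + LineDeriv.lineDerivOp v (toSchwartz ψ)) := by
    ext x
    rw [_root_.add_apply, SchwartzMap.lineDerivOp_apply, coe_toSchwartz]
    push_cast
    congr 1
    have hd : DifferentiableAt ℝ ψ x := (ψ.contDiff.differentiable (by simp)).differentiableAt
    have h := Complex.ofRealCLM.hasFDerivAt.comp x hd.hasFDerivAt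
    rw [hd.lineDeriv_eq_fderiv]
    exact (h.hasLineDerivAt v).lineDeriv.symm
  rw [h1, ← coe_toSchwartz, ← SchwartzMap.fourier_coe, ← SchwartzMap.fourier_coe,
    FourierTransform.fourier_add, SchwartzMap.fourier_lineDerivOp_eq, _root_.add_apply,
    _root_.smul_apply,
    SchwartzMap.smulLeftCLM_apply_apply (by fun_prop)]
  have h2 : ∀ (r : ℝ) (z : ℂ), ‖z + (2 * Real.pi * Complex.I) • (r • z)‖ ^ 2
      = (1 + (2 * Real.pi * r) ^ 2) * ‖z‖ ^ 2 := by
    intro r z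
    have h3 : z + (2 * Real.pi * Complex.I : ℂ) • (r • z) = ⟨1, 2 * Real.pi * r⟩ * z := by
      rw [Complex.mk_eq_add_mul_I]
      simp
      ring
    rw [h3, norm_mul, mul_pow, ← Complex.normSq_eq_norm_sq ⟨1, 2 * Real.pi * r⟩, Complex.normSq_mk]
    ring
  exact h2 _ _

/-- Existence of the field: the spectral density of the logarithmic kernel is not integrable, but
it becomes so after division by `1 + (2π ξ i)²`, and the corresponding Gaussian function is
differentiated once in the direction `i` in the sense of distributions. -/
theorem exists_isLogCorrelatedWith {d : ℕ} (hd : 1 ≤ d) {D : Opens (Rn d)}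
    (hD : Bornology.IsBounded (D : Set (Rn d))) :
    ∃ (Ω : Type) (_ : MeasurableSpace Ω) (P : Measure Ω) (_ : IsProbabilityMeasure P)
      (X : Ω → 𝓓'(D, ℝ)), ∀ h : Rn d → ℝ, ContDiff ℝ (⊤ : ℕ∞) h → HasCompactSupport h →
        (∀ y ∈ D, ∀ z ∈ D, y ≠ z → covKernel h y z = logKernel (z - y)) →
        IsLogCorrelatedWith D P X h := by
  have : Nonempty (Fin d) := ⟨⟨0, hd⟩⟩
  set i : Fin d := ⟨0, hd⟩
  set v : Rn d := EuclideanSpace.single i 1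
  set L : 𝓓(D, ℝ) →L[ℝ] 𝓓(D, ℝ) :=
    ContinuousLinearMap.id ℝ 𝓓(D, ℝ) + TestFunction.lineDerivCLM ℝ v
  obtain ⟨Ω, mΩ, P, hP, X, hX⟩ := exists_random_distribution hD L
    (integrable_covSpectrum_mul hd i)
    (fun ξ => mul_nonneg (covSpectrum_nonneg ξ) (by positivity))
  have hK := integrable_logKernel hd
  have heven : ∀ x : Rn d, logKernel (-x) = logKernel x := fun x => by simp [logKernel]
  have hquad := fun ψ : 𝓓(D, ℝ) => integral_covSpectrum_mul hd (integrable_testFunction ψ)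
    (exists_abs_testFunction_le ψ).choose_spec
  have hlaw : ∀ ψ : 𝓓(D, ℝ), P.map (fun ω => X ω ψ)
      = gaussianReal 0 (kernelForm D hK ψ ψ).toNNReal := by
    intro ψ
    rw [(hX ψ).2, kernelForm_apply, ← (hquad ψ).2]
    congr 2
    refine integral_congr_ae (Filter.Eventually.of_forall fun ξ => ?_)
    have hL : (fun x => (L ψ x : ℂ)) = fun x => ((ψ x + lineDeriv ℝ ψ x v : ℝ) : ℂ) := by
      ext x
      congr 1
      change (ψ + TestFunction.lineDerivCLM ℝ v ψ : 𝓓(D, ℝ)) x = _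
      rw [_root_.add_apply, TestFunction.lineDerivCLM_apply_of_le (by simp)]
    have hv : inner ℝ ξ v = ξ i := by
      rw [EuclideanSpace.inner_single_right]; simp
    simp only
    rw [hL, norm_fourier_add_lineDeriv_sq, hv]
    have : (1 + (2 * Real.pi * ξ i) ^ 2) ≠ 0 := by positivity
    field_simp
  refine ⟨Ω, mΩ, P, hP, X, fun h hsm hsupp hh => ?_⟩
  have hmeas := fun ψ => (hX ψ).1
  refine ⟨hmeas, ?_, fun ψ => ?_, hsm, hsupp, fun ψ₁ ψ₂ => ?_⟩
  · exact isGaussianProcess_of_map_eq (X := fun ω => (X ω).toLinearMap) hmeas hlaw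
  · exact integral_eq_zero_of_map_eq (X := fun ω => (X ω).toLinearMap) hmeas hlaw ψ
  · rw [setIntegral_kernel_eq ψ₁ ψ₂ (K := logKernel) fun x hx y hy hxy => by
      rw [hh x hx y hy hxy, ← heven, neg_sub], ← kernelForm_apply hK]
    refine integral_mul_of_map_eq (X := fun ω => (X ω).toLinearMap) hmeas hlaw (fun ψ => ?_)
      (kernelForm_comm hK heven) ψ₁ ψ₂
    rw [kernelForm_apply]
    exact (hquad ψ).1

end LogCorrelated

theorem lemma5p4 (d : ℕ) (hd : 1 ≤ d) (D : Opens (LogCorrelated.Rn d))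
    (hD : Bornology.IsBounded (D : Set (LogCorrelated.Rn d))) :
    ∃ (Ω : Type) (_ : MeasurableSpace Ω) (P : Measure Ω) (_ : IsProbabilityMeasure P)
      (X : Ω → 𝓓'(D, ℝ)),
      LogCorrelated.IsLogCorrelated D P X ∧
        ∀ β : ℝ, 0 < β → β < Real.sqrt d → LogCorrelated.IsNonDegenerate D P X β := by
  have : Nonempty (Fin d) := ⟨⟨0, hd⟩⟩
  obtain ⟨h, hsm, hsupp, hh⟩ := LogCorrelated.exists_covKernel_eq hD
  obtain ⟨Ω, mΩ, P, hP, X, hX⟩ := LogCorrelated.exists_isLogCorrelatedWith hd hD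
  have hXh := hX h hsm hsupp hh
  exact ⟨Ω, mΩ, P, hP, X, ⟨h, hXh⟩, fun β hβ hβd =>
    ⟨h, hXh, LogCorrelated.exists_dualSobolevNorm_le hh hβ hβd⟩⟩
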